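/- Let $n\in\mathbb N$. Let $S(\mathbb R^m)$ be the Schwartz space of complex-valued rapidly decreasing smooth functions on $\mathbb R^m$ and let $S'(\mathbb R^m)$ be its topological dual, the space of tempered distributions; a function $w\in S(\mathbb R^m)$ is identified with the tempered distribution $v\mapsto\int_{\mathbb R^m} v\,w$. For $t\in\mathbb R$ let $$\varphi_t(x,\xi)=\big(\cos t\;x+\sin t\;\xi,\;-\sin t\;x+\cos t\;\xi\big),\qquad (x,\xi)\in\mathbb R^n\times\mathbb R^n,$$ be the flow of the classical harmonic oscillator $h_0(x,\xi)=\frac12(\|x\|^2+\|\xi\|^2)$. A distribution $f\in S'(\mathbb R^{2n})$ is called a tempered constant of motion of the harmonic oscillator if $f(g\circ\varphi_t)=f(g)$ for all $t\in\mathbb R$ and all $g\in S(\mathbb R^{2n})$. For $f\in S'(\mathbb R^{2n})$, the Weyl operator $\mathfrak{Op}(f):S(\mathbb R^n)\to S'(\mathbb R^n)$ is defined by $$\big(\mathfrak{Op}(f)u\big)(v)=K_f(v\otimes u),\qquad u,v\in S(\mathbb R^n),\quad (v\otimes u)(x,y)=v(x)u(y),$$ where the kernel $K_f\in S'(\mathbb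 R^{2n})$ is $$K_f(x,y)=\big((I\otimes\mathcal F)f\big)\Big(\frac{x+y}{2},\,y-x\Big).$$ Here $I\otimes\mathcal F$ is the Fourier transform in the second variable, $((I\otimes\mathcal F)h)(x,\eta)=\int_{\mathbb R^n}e^{-i\xi\cdot\eta}h(x,\xi)\,d\xi$ for $h\in S(\mathbb R^{2n})$, extended to $S'(\mathbb R^{2n})$ by duality, and composition with the linear volume-preserving map $(x,y)\mapsto(\frac{x+y}{2},y-x)$ is likewise extended to $S'(\mathbb R^{2n})$ by duality. (Formally, $\mathfrak{Op}(f)u(x)=\int\!\!\int f(\frac{x+y}{2},\xi)e^{i(x-y)\cdot\xi}u(y)\,d\xi\,dy$.) **Theorem.** If $f\in S'(\mathbb R^{2n})$ is a tempered constant of motion of the harmonic oscillator, then $\mathfrak{Op}(f)$ maps $S(\mathbb R^n)$ into itself: for every $u\in S(\mathbb R^n)$ the tempered distribution $\mathfrak{Op}(f)u$ belongs to $S(\mathbb R^n)$. -/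

import Mathlib

open scoped SchwartzMap ContDiff

namespace WeylHO

noncomputable section

/-! ### The configuration space -/

/-- The configuration space `ℝⁿ` with its Euclidean structure.  The phase space `ℝ²ⁿ` is
`Conf n × Conf n`, whose points are the pairs `(x, ξ)`. -/
abbrev Conf (n : ℕ) : Type := EuclideanSpace ℝ (Fin n)

/-! ### The flow of the classical harmonic oscillator -/

/-- The time-`t` flow `(x, ξ) ↦ (cos t x + sin t ξ, - sin t x + cos t ξ)` of the Hamiltonian
`(‖x‖² + ‖ξ‖²) / 2`. -/
def flow (n : ℕ) (t : ℝ) : (Conf n × Conf n) ≃L[ℝ] (Conf n × Conf n) :=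
  ContinuousLinearEquiv.equivOfInverse
    ((Real.cos t • ContinuousLinearMap.fst ℝ (Conf n) (Conf n) +
        Real.sin t • ContinuousLinearMap.snd ℝ (Conf n) (Conf n)).prod
      (-Real.sin t • ContinuousLinearMap.fst ℝ (Conf n) (Conf n) +
        Real.cos t • ContinuousLinearMap.snd ℝ (Conf n) (Conf n)))
    ((Real.cos t • ContinuousLinearMap.fst ℝ (Conf n) (Conf n) -
        Real.sin t • ContinuousLinearMap.snd ℝ (Conf n) (Conf n)).prod
      (Real.sin t • ContinuousLinearMap.fst ℝ (Conf n) (Conf n) +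
        Real.cos t • ContinuousLinearMap.snd ℝ (Conf n) (Conf n)))
    (by
      rintro ⟨x, ξ⟩
      have h := Real.sin_sq_add_cos_sq t
      ext i
      · simp
        linear_combination x i * h
      · simp
        linear_combination ξ i * h)
    (by
      rintro ⟨x, ξ⟩
      have h := Real.sin_sq_add_cos_sq t
      ext i
      · simp
        linear_combination x i * h
      · simp
        linear_combination ξ i * h)

/-- The pullback `φ_t^* T` of a tempered distribution, `(φ_t^* T)(g) = T (g ∘ φ_t)`. -/
def flowPullback (n : ℕ) (t : ℝ) (T : 𝓢'(Conf n × Conf n, ℂ)) : 𝓢'(Conf n × Conf n, ℂ) :=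
  PointwiseConvergenceCLM.precomp ℂ
    (SchwartzMap.compCLMOfContinuousLinearEquiv ℂ (flow n t)) T

/-- A tempered constant of motion of the harmonic oscillator: a tempered distribution on phase
space that is invariant under the flow. -/
def IsTemperedConstantOfMotion {n : ℕ} (T : 𝓢'(Conf n × Conf n, ℂ)) : Prop :=
  ∀ t : ℝ, flowPullback n t T = T

/-! ### Tensor products of Schwartz functions -/

/-- The tensor product of two functions, `(v ⊗ u)(x, y) = v x * u y`. -/
def tensorFun {n : ℕ} (v u : Conf n → ℂ) (z : Conf n × Conf n) : ℂ := v z.1 * u z.2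

theorem contDiff_tensorFun {n : ℕ} (v u : 𝓢(Conf n, ℂ)) : ContDiff ℝ ∞ (tensorFun v u) := by
  unfold tensorFun
  exact ((v.smooth ⊤).comp contDiff_fst).mul ((u.smooth ⊤).comp contDiff_snd)

theorem norm_iteratedFDeriv_comp_clm_le {V W G : Type*} [NormedAddCommGroup V] [NormedSpace ℝ V]
    [NormedAddCommGroup W] [NormedSpace ℝ W] [NormedAddCommGroup G] [NormedSpace ℝ G]
    (L : V →L[ℝ] W) (hL : ‖L‖ ≤ 1) {g : W → G} (hg : ContDiff ℝ ∞ g) (i : ℕ) (z : V) :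
    ‖iteratedFDeriv ℝ i (fun z => g (L z)) z‖ ≤ ‖iteratedFDeriv ℝ i g (L z)‖ := by
  have h := L.iteratedFDeriv_comp_right hg z (i := i) (by exact_mod_cast le_top)
  change iteratedFDeriv ℝ i (fun z => g (L z)) z = _ at h
  rw [h]
  refine (ContinuousMultilinearMap.norm_compContinuousLinearMap_le _ _).trans ?_
  refine mul_le_of_le_one_right (norm_nonneg _) ?_
  simpa using pow_le_one₀ (norm_nonneg _) hL

theorem tensorFun_bound {n : ℕ} (k m : ℕ) (v u : 𝓢(Conf n, ℂ)) (z : Conf n × Conf n) :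
    ‖z‖ ^ k * ‖iteratedFDeriv ℝ m (tensorFun v u) z‖ ≤
      2 ^ m * (2 ^ k * (Finset.Iic (k, m)).sup (schwartzSeminormFamily ℂ (Conf n) ℂ) v) *
        (2 ^ k * (Finset.Iic (k, m)).sup (schwartzSeminormFamily ℂ (Conf n) ℂ) u) := by
  set Sv := 2 ^ k * (Finset.Iic (k, m)).sup (schwartzSeminormFamily ℂ (Conf n) ℂ) v
  set Su := 2 ^ k * (Finset.Iic (k, m)).sup (schwartzSeminormFamily ℂ (Conf n) ℂ) u
  have hSv : 0 ≤ Sv := mul_nonneg (by positivity) (apply_nonneg _ _)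
  have hleib := norm_iteratedFDeriv_mul_le (𝕜 := ℝ) (n := m) (N := ∞)
    (f := fun z : Conf n × Conf n => v z.1) (g := fun z : Conf n × Conf n => u z.2)
    ((v.smooth ⊤).comp contDiff_fst) ((u.smooth ⊤).comp contDiff_snd) z (by exact_mod_cast le_top)
  have hz : ‖z‖ ^ k ≤ (1 + ‖z.1‖) ^ k * (1 + ‖z.2‖) ^ k := by
    rw [← mul_pow]
    refine pow_le_pow_left₀ (norm_nonneg _) ?_ _
    have h1 := norm_nonneg z.1
    have h2 := norm_nonneg z.2
    have h3 := mul_nonneg h1 h2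
    rw [Prod.norm_def]
    exact max_le (by nlinarith) (by nlinarith)
  have hterm : ∀ i ∈ Finset.range (m + 1),
      ((1 + ‖z.1‖) ^ k * (1 + ‖z.2‖) ^ k) * ((m.choose i : ℝ) *
        ‖iteratedFDeriv ℝ i (fun z : Conf n × Conf n => v z.1) z‖ *
        ‖iteratedFDeriv ℝ (m - i) (fun z : Conf n × Conf n => u z.2) z‖) ≤
      (m.choose i : ℝ) * (Sv * Su) := by
    intro i hi
    have hi' : i ≤ m := Nat.lt_succ_iff.mp (Finset.mem_range.mp hi)
    have a1 := norm_iteratedFDeriv_comp_clm_le (ContinuousLinearMap.fst ℝ (Conf n) (Conf n))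
      (ContinuousLinearMap.norm_fst_le _ _ _) (v.smooth ⊤) i z
    have a2 := norm_iteratedFDeriv_comp_clm_le (ContinuousLinearMap.snd ℝ (Conf n) (Conf n))
      (ContinuousLinearMap.norm_snd_le _ _ _) (u.smooth ⊤) (m - i) z
    have b1 : (1 + ‖z.1‖) ^ k * ‖iteratedFDeriv ℝ i v z.1‖ ≤ Sv :=
      SchwartzMap.one_add_le_sup_seminorm_apply (𝕜 := ℂ) (m := (k, m)) le_rfl hi' v z.1
    have b2 : (1 + ‖z.2‖) ^ k * ‖iteratedFDeriv ℝ (m - i) u z.2‖ ≤ Su :=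
      SchwartzMap.one_add_le_sup_seminorm_apply (𝕜 := ℂ) (m := (k, m)) le_rfl
        (Nat.sub_le m i) u z.2
    have c1 := (mul_le_mul_of_nonneg_left a1 (by positivity : 0 ≤ (1 + ‖z.1‖) ^ k)).trans b1
    have c2 := (mul_le_mul_of_nonneg_left a2 (by positivity : 0 ≤ (1 + ‖z.2‖) ^ k)).trans b2
    have c3 := mul_le_mul c1 c2 (by positivity) hSv
    have c4 := mul_le_mul_of_nonneg_left c3 (Nat.cast_nonneg (α := ℝ) (m.choose i))
    refine le_trans (le_of_eq ?_) c4
    simp only [ContinuousLinearMap.coe_fst', ContinuousLinearMap.coe_snd']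
    ring
  calc ‖z‖ ^ k * ‖iteratedFDeriv ℝ m (tensorFun v u) z‖
      ≤ ((1 + ‖z.1‖) ^ k * (1 + ‖z.2‖) ^ k) * _ :=
        mul_le_mul hz hleib (norm_nonneg _) (by positivity)
    _ ≤ ∑ i ∈ Finset.range (m + 1), (m.choose i : ℝ) * (Sv * Su) := by
        rw [Finset.mul_sum]
        exact Finset.sum_le_sum hterm
    _ = 2 ^ m * Sv * Su := by
        rw [← Finset.sum_mul, ← Nat.cast_sum, Nat.sum_range_choose]
        push_cast
        ring

/-- The map `v ↦ v ⊗ u` for fixed `u`. -/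
def tensorLeftCLM {n : ℕ} (u : 𝓢(Conf n, ℂ)) : 𝓢(Conf n, ℂ) →L[ℂ] 𝓢(Conf n × Conf n, ℂ) :=
  SchwartzMap.mkCLM (fun v => tensorFun v u)
    (fun v w z => by simp [tensorFun, add_mul])
    (fun a v z => by simp [tensorFun, mul_assoc])
    (fun v => contDiff_tensorFun v u) <| by
  rintro ⟨k, m⟩
  refine ⟨Finset.Iic (k, m), 2 ^ m * 2 ^ k *
    (2 ^ k * (Finset.Iic (k, m)).sup (schwartzSeminormFamily ℂ (Conf n) ℂ) u), ?_, fun v z => ?_⟩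
  · exact mul_nonneg (by positivity) (mul_nonneg (by positivity) (apply_nonneg _ _))
  · exact (tensorFun_bound k m v u z).trans (le_of_eq (by ring))

/-- The map `u ↦ v ⊗ u` for fixed `v`. -/
def tensorRightCLM {n : ℕ} (v : 𝓢(Conf n, ℂ)) : 𝓢(Conf n, ℂ) →L[ℂ] 𝓢(Conf n × Conf n, ℂ) :=
  SchwartzMap.mkCLM (fun u => tensorFun v u)
    (fun u w z => by simp [tensorFun, mul_add])
    (fun a u z => by simp [tensorFun, mul_left_comm])
    (fun u => contDiff_tensorFun v u) <| by
  rintro ⟨k, m⟩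
  refine ⟨Finset.Iic (k, m), 2 ^ m *
    (2 ^ k * (Finset.Iic (k, m)).sup (schwartzSeminormFamily ℂ (Conf n) ℂ) v) * 2 ^ k, ?_,
    fun u z => ?_⟩
  · exact mul_nonneg (mul_nonneg (by positivity) (mul_nonneg (by positivity) (apply_nonneg _ _)))
      (by positivity)
  · exact (tensorFun_bound k m v u z).trans (le_of_eq (by ring))

theorem tensorLeftCLM_apply {n : ℕ} (v u : 𝓢(Conf n, ℂ)) (z : Conf n × Conf n) :
    tensorLeftCLM u v z = v z.1 * u z.2 := rfl

theorem tensorLeftCLM_eq_tensorRightCLM {n : ℕ} (v u : 𝓢(Conf n, ℂ)) :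
    tensorLeftCLM u v = tensorRightCLM v u := rfl

/-! ### The partial Fourier transform in the momentum variable -/

/-- The Fourier transform in the second variable,
`((I ⊗ 𝓕) h)(x, η) = ∫ exp (-i ⟨ξ, η⟩) h(x, ξ) dξ`. -/
def partialFourierFun {n : ℕ} {G : Type} [NormedAddCommGroup G] [NormedSpace ℂ G]
    (h : Conf n × Conf n → G) (z : Conf n × Conf n) : G :=
  ∫ ξ : Conf n, Complex.exp (-(Complex.I * ((inner ℝ ξ z.2 : ℝ) : ℂ))) • h (z.1, ξ)

section PartialFourier

variable {n : ℕ} {G : Type} [NormedAddCommGroup G] [NormedSpace ℂ G]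

/-- The pairing `(x, ξ) ↦ ((a, b) ↦ ⟨ξ, b⟩)`. -/
def phasePairing (n : ℕ) : (Conf n × Conf n) →L[ℝ] (Conf n × Conf n) →L[ℝ] ℝ :=
  ((innerSL ℝ (E := Conf n)).bilinearComp (ContinuousLinearMap.snd ℝ (Conf n) (Conf n))
    (ContinuousLinearMap.snd ℝ (Conf n) (Conf n)))

/-- Restriction of a real-linear map on phase space to the position directions. -/
def positionPartCLM (n : ℕ) (G : Type) [NormedAddCommGroup G] [NormedSpace ℂ G] :
    ((Conf n × Conf n) →L[ℝ] G) →L[ℂ] ((Conf n × Conf n) →L[ℝ] G) :=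
  LinearMap.mkContinuous
    { toFun := fun A => A.comp ((ContinuousLinearMap.inl ℝ (Conf n) (Conf n)).comp
        (ContinuousLinearMap.fst ℝ (Conf n) (Conf n)))
      map_add' := fun _ _ => rfl
      map_smul' := fun _ _ => rfl }
    ‖(ContinuousLinearMap.inl ℝ (Conf n) (Conf n)).comp
        (ContinuousLinearMap.fst ℝ (Conf n) (Conf n))‖
    (fun A => by
      rw [mul_comm]
      exact ContinuousLinearMap.opNorm_comp_le _ _)

/-- Differentiation under the integral sign, on the level of amplitudes: the derivative of the
partial Fourier transform of `h` is the partial Fourier transform of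
`(x, ξ) ↦ ((a, b) ↦ D h(x, ξ)(a, 0) - i ⟨ξ, b⟩ h(x, ξ))`. -/
def amplitudeCLM (n : ℕ) (G : Type) [NormedAddCommGroup G] [NormedSpace ℂ G] :
    𝓢(Conf n × Conf n, G) →L[ℂ] 𝓢(Conf n × Conf n, (Conf n × Conf n) →L[ℝ] G) :=
  (SchwartzMap.postcompCLM (𝕜 := ℂ) (positionPartCLM n G)) ∘L
    SchwartzMap.fderivCLM ℂ (Conf n × Conf n) G
  + (-Complex.I) • SchwartzMap.smulRightCLM ℂ G (phasePairing n)

theorem amplitudeCLM_apply (h : 𝓢(Conf n × Conf n, G)) (z w : Conf n × Conf n) :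
    amplitudeCLM n G h z w =
      fderiv ℝ h z (w.1, 0) - Complex.I • ((inner ℝ z.2 w.2 : ℝ) • h z) := by
  have : amplitudeCLM n G h z w =
      fderiv ℝ h z (w.1, 0) + (-Complex.I) • ((inner ℝ z.2 w.2 : ℝ) • h z) := rfl
  rw [this, neg_smul, sub_eq_add_neg]

theorem norm_kernel (ξ η : Conf n) (a : G) :
    ‖Complex.exp (-(Complex.I * ((inner ℝ ξ η : ℝ) : ℂ))) • a‖ = ‖a‖ := by
  rw [norm_smul]
  have : -(Complex.I * ((inner ℝ ξ η : ℝ) : ℂ)) = ((-(inner ℝ ξ η : ℝ) : ℝ) : ℂ) * Complex.I := by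
    push_cast
    ring
  rw [this, Complex.norm_exp_ofReal_mul_I, one_mul]

/-- An integrable weight on `ℝⁿ`. -/
def weight {n : ℕ} (ξ : Conf n) : ℝ := (1 + ‖ξ‖) ^ (-((n + 1 : ℕ) : ℝ))

theorem integrable_weight : MeasureTheory.Integrable (weight (n := n)) := by
  apply integrable_one_add_norm
  rw [finrank_euclideanSpace_fin]
  push_cast
  linarith

theorem fiber_bound (k : ℕ) (h : 𝓢(Conf n × Conf n, G)) (x ξ : Conf n) :
    ‖x‖ ^ k * ‖h (x, ξ)‖ ≤ 2 ^ (k + (n + 1)) *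
      (Finset.Iic (k + (n + 1), 0)).sup (schwartzSeminormFamily ℂ (Conf n × Conf n) G) h *
        weight ξ := by
  have h0 := SchwartzMap.one_add_le_sup_seminorm_apply (𝕜 := ℂ) (m := (k + (n + 1), 0))
    le_rfl le_rfl h (x, ξ)
  rw [norm_iteratedFDeriv_zero] at h0
  have h1 : (0 : ℝ) < 1 + ‖ξ‖ := by positivity
  rw [weight, Real.rpow_neg h1.le, Real.rpow_natCast, ← div_eq_mul_inv,
    le_div_iff₀ (by positivity)]
  refine le_trans ?_ h0
  have h2 : ‖x‖ ^ k * (1 + ‖ξ‖) ^ (n + 1) ≤ (1 + ‖((x, ξ) : Conf n × Conf n)‖) ^ (k + (n + 1)) := by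
    rw [pow_add _ k (n + 1)]
    have hx : ‖x‖ ≤ ‖((x, ξ) : Conf n × Conf n)‖ := norm_fst_le (x, ξ)
    have hξ : ‖ξ‖ ≤ ‖((x, ξ) : Conf n × Conf n)‖ := norm_snd_le (x, ξ)
    have g1 : ‖x‖ ^ k ≤ (1 + ‖((x, ξ) : Conf n × Conf n)‖) ^ k :=
      pow_le_pow_left₀ (norm_nonneg _) (by linarith) _
    have g2 : (1 + ‖ξ‖) ^ (n + 1) ≤ (1 + ‖((x, ξ) : Conf n × Conf n)‖) ^ (n + 1) :=
      pow_le_pow_left₀ h1.le (by linarith) _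
    exact mul_le_mul g1 g2 (by positivity) (by positivity)
  calc ‖x‖ ^ k * ‖h (x, ξ)‖ * (1 + ‖ξ‖) ^ (n + 1)
      = (‖x‖ ^ k * (1 + ‖ξ‖) ^ (n + 1)) * ‖h (x, ξ)‖ := by ring
    _ ≤ _ := by gcongr

theorem continuous_integrand (h : 𝓢(Conf n × Conf n, G)) (z : Conf n × Conf n) :
    Continuous (fun ξ : Conf n =>
      Complex.exp (-(Complex.I * ((inner ℝ ξ z.2 : ℝ) : ℂ))) • h (z.1, ξ)) := by
  have := h.continuous
  fun_prop

theorem integrable_integrand (h : 𝓢(Conf n × Conf n, G)) (z : Conf n × Conf n) :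
    MeasureTheory.Integrable (fun ξ : Conf n =>
      Complex.exp (-(Complex.I * ((inner ℝ ξ z.2 : ℝ) : ℂ))) • h (z.1, ξ)) := by
  refine (integrable_weight.const_mul (2 ^ (0 + (n + 1)) *
      (Finset.Iic (0 + (n + 1), 0)).sup (schwartzSeminormFamily ℂ (Conf n × Conf n) G) h)).mono'
    (continuous_integrand h z).aestronglyMeasurable (Filter.Eventually.of_forall fun ξ => ?_)
  rw [norm_kernel]
  simpa using fiber_bound 0 h z.1 ξ

theorem hasFDerivAt_integrand (h : 𝓢(Conf n × Conf n, G)) (ξ : Conf n) (z : Conf n × Conf n) :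
    HasFDerivAt (fun z : Conf n × Conf n =>
        Complex.exp (-(Complex.I * ((inner ℝ ξ z.2 : ℝ) : ℂ))) • h (z.1, ξ))
      (Complex.exp (-(Complex.I * ((inner ℝ ξ z.2 : ℝ) : ℂ))) • amplitudeCLM n G h (z.1, ξ)) z := by
  have hlin : HasFDerivAt (fun z : Conf n × Conf n => ((inner ℝ ξ z.2 : ℝ) : ℂ))
      (Complex.ofRealCLM.comp
        ((innerSL ℝ ξ).comp (ContinuousLinearMap.snd ℝ (Conf n) (Conf n)))) z :=
    (Complex.ofRealCLM.comp
      ((innerSL ℝ ξ).comp (ContinuousLinearMap.snd ℝ (Conf n) (Conf n)))).hasFDerivAt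
  have h1 := ((hlin.const_mul Complex.I).neg).cexp
  have h2 : HasFDerivAt (fun z : Conf n × Conf n => h (z.1, ξ))
      ((fderiv ℝ h (z.1, ξ)).comp ((ContinuousLinearMap.inl ℝ (Conf n) (Conf n)).comp
        (ContinuousLinearMap.fst ℝ (Conf n) (Conf n)))) z := by
    have hh : HasFDerivAt h (fderiv ℝ h (z.1, ξ)) (z.1, ξ) := h.hasFDerivAt _
    have hg : HasFDerivAt (fun z : Conf n × Conf n => (z.1, ξ))
        ((ContinuousLinearMap.inl ℝ (Conf n) (Conf n)).comp
        (ContinuousLinearMap.fst ℝ (Conf n) (Conf n))) z := by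
      have := (hasFDerivAt_fst (𝕜 := ℝ) (p := z)).prodMk (hasFDerivAt_const ξ z)
      refine this.congr_fderiv ?_
      ext <;> simp
    exact HasFDerivAt.comp (g := h) (f := fun z : Conf n × Conf n => (z.1, ξ)) z hh hg
  refine (h1.smul h2).congr_fderiv (ContinuousLinearMap.ext fun w => ?_)
  simp only [_root_.add_apply, _root_.smul_apply, amplitudeCLM_apply,
    ContinuousLinearMap.smulRight_apply]
  have e1 : (-(Complex.I • Complex.ofRealCLM.comp
      ((innerSL ℝ ξ).comp (ContinuousLinearMap.snd ℝ (Conf n) (Conf n)))) :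
        (Conf n × Conf n) →L[ℝ] ℂ) w = -(Complex.I * ((inner ℝ ξ w.2 : ℝ) : ℂ)) := rfl
  rw [e1, smul_sub, smul_assoc, neg_smul, smul_neg, ← sub_eq_add_neg, mul_smul,
    Complex.coe_smul]
  rfl

theorem position_decay (k : ℕ) (h : 𝓢(Conf n × Conf n, G)) (z : Conf n × Conf n) :
    ‖z.1‖ ^ k * ‖partialFourierFun h z‖ ≤
      2 ^ (k + (n + 1)) * (∫ ξ : Conf n, weight ξ) *
        (Finset.Iic (k + (n + 1), 0)).sup (schwartzSeminormFamily ℂ (Conf n × Conf n) G) h := by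
  calc ‖z.1‖ ^ k * ‖partialFourierFun h z‖
      = ‖∫ ξ : Conf n, ‖z.1‖ ^ k •
          (Complex.exp (-(Complex.I * ((inner ℝ ξ z.2 : ℝ) : ℂ))) • h (z.1, ξ))‖ := by
        rw [MeasureTheory.integral_smul, norm_smul, norm_pow, norm_norm]
        rfl
    _ ≤ ∫ ξ : Conf n, 2 ^ (k + (n + 1)) *
        (Finset.Iic (k + (n + 1), 0)).sup (schwartzSeminormFamily ℂ (Conf n × Conf n) G) h *
          weight ξ := by
        refine MeasureTheory.norm_integral_le_of_norm_le (integrable_weight.const_mul _)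
          (Filter.Eventually.of_forall fun ξ => ?_)
        rw [norm_smul, norm_kernel, norm_pow, norm_norm]
        exact fiber_bound k h z.1 ξ
    _ = _ := by
        rw [MeasureTheory.integral_const_mul]
        ring

/-- The restriction `ξ ↦ h(x, ξ)` of a Schwartz function to a fibre. -/
def fiber (x : Conf n) : 𝓢(Conf n × Conf n, G) →L[ℂ] 𝓢(Conf n, G) :=
  SchwartzMap.compCLM ℂ (g := fun ξ => (x, ξ))
    (by
      have h := ((ContinuousLinearMap.inr ℝ (Conf n) (Conf n)).hasTemperateGrowth).add
        (Function.HasTemperateGrowth.const (E := Conf n) ((x, 0) : Conf n × Conf n))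
      have e : (⇑(ContinuousLinearMap.inr ℝ (Conf n) (Conf n)) + fun _ => (x, 0)) =
          fun ξ => (x, ξ) := by
        ext ξ <;> simp
      rwa [e] at h)
    ⟨1, 1, fun ξ => by
      have hξ : ‖ξ‖ ≤ ‖((x, ξ) : Conf n × Conf n)‖ := norm_snd_le (x, ξ)
      linarith⟩

theorem seminorm_fiber_le (x : Conf n) (h : 𝓢(Conf n × Conf n, G)) (k m : ℕ) :
    SchwartzMap.seminorm ℂ k m (fiber x h) ≤ SchwartzMap.seminorm ℂ k m h := by
  refine SchwartzMap.seminorm_le_bound ℂ k m _ (apply_nonneg _ _) fun ξ => ?_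
  refine le_trans ?_ (SchwartzMap.le_seminorm ℂ k m h (x, ξ))
  have hξ : ‖ξ‖ ≤ ‖((x, ξ) : Conf n × Conf n)‖ := norm_snd_le (x, ξ)
  have hg : ContDiff ℝ ∞ (fun w : Conf n × Conf n => h (w + (x, 0))) :=
    (h.smooth ⊤).comp (contDiff_id.add contDiff_const)
  have h1 := norm_iteratedFDeriv_comp_clm_le (ContinuousLinearMap.inr ℝ (Conf n) (Conf n))
    (ContinuousLinearMap.norm_inr_le_one _ _ _) hg m ξ
  rw [iteratedFDeriv_comp_add_right] at h1
  have h2 : (fun ξ : Conf n => h (ContinuousLinearMap.inr ℝ (Conf n) (Conf n) ξ + (x, 0))) =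
      fiber x h := by
    ext ξ
    simp [fiber]
  rw [h2] at h1
  have h3 : ContinuousLinearMap.inr ℝ (Conf n) (Conf n) ξ + (x, 0) = (x, ξ) := by simp
  rw [h3] at h1
  gcongr

theorem partialFourierFun_eq_fourier (h : 𝓢(Conf n × Conf n, G)) (z : Conf n × Conf n) :
    partialFourierFun h z =
      SchwartzMap.fourierTransformCLM ℂ (fiber z.1 h) ((2 * Real.pi)⁻¹ • z.2) := by
  rw [SchwartzMap.fourierTransformCLM_apply, SchwartzMap.fourier_coe, Real.fourier_eq']
  unfold partialFourierFun
  congr 1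
  ext ξ
  congr 2
  rw [real_inner_smul_right]
  have := Real.pi_ne_zero
  push_cast
  field_simp

theorem hasFDerivAt_partialFourierFun (h : 𝓢(Conf n × Conf n, G)) (z : Conf n × Conf n) :
    HasFDerivAt (partialFourierFun h) (partialFourierFun (amplitudeCLM n G h) z) z := by
  refine hasFDerivAt_integral_of_dominated_of_fderiv_le (s := Set.univ)
    (bound := fun ξ => 2 ^ (0 + (n + 1)) * (Finset.Iic (0 + (n + 1), 0)).sup
      (schwartzSeminormFamily ℂ (Conf n × Conf n) ((Conf n × Conf n) →L[ℝ] G))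
        (amplitudeCLM n G h) * weight ξ)
    Filter.univ_mem
    (Filter.Eventually.of_forall fun z => (continuous_integrand h z).aestronglyMeasurable)
    (integrable_integrand h z)
    (continuous_integrand (amplitudeCLM n G h) z).aestronglyMeasurable
    (Filter.Eventually.of_forall fun ξ z _ => ?_)
    (integrable_weight.const_mul _)
    (Filter.Eventually.of_forall fun ξ z _ => hasFDerivAt_integrand h ξ z)
  refine (norm_kernel (G := (Conf n × Conf n) →L[ℝ] G) ξ z.2 _).le.trans ?_
  simpa using fiber_bound 0 (amplitudeCLM n G h) z.1 ξ

theorem fderiv_partialFourierFun (h : 𝓢(Conf n × Conf n, G)) :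
    fderiv ℝ (partialFourierFun h) = partialFourierFun (amplitudeCLM n G h) :=
  funext fun z => (hasFDerivAt_partialFourierFun h z).fderiv

theorem momentum_decay (k : ℕ) : ∃ (s : Finset (ℕ × ℕ)) (C : ℝ), 0 ≤ C ∧
    ∀ (h : 𝓢(Conf n × Conf n, G)) (z : Conf n × Conf n), ‖z.2‖ ^ k * ‖partialFourierFun h z‖ ≤
      C * s.sup (schwartzSeminormFamily ℂ (Conf n × Conf n) G) h := by
  obtain ⟨s, C, -, hC⟩ := Seminorm.bound_of_continuous (schwartz_withSeminorms ℂ (Conf n) G)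
    ((SchwartzMap.seminorm ℂ k 0 : Seminorm ℂ 𝓢(Conf n, G)).comp
      (SchwartzMap.fourierTransformCLM ℂ : 𝓢(Conf n, G) →L[ℂ] 𝓢(Conf n, G)).toLinearMap)
    (Continuous.comp (g := SchwartzMap.seminorm ℂ k 0)
      ((schwartz_withSeminorms ℂ (Conf n) G).continuous_seminorm (k, 0))
      (SchwartzMap.fourierTransformCLM ℂ : 𝓢(Conf n, G) →L[ℂ] 𝓢(Conf n, G)).continuous)
  refine ⟨s, (2 * Real.pi) ^ k * C, by positivity, fun h z => ?_⟩
  have h1 := SchwartzMap.norm_pow_mul_le_seminorm ℂ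
    (SchwartzMap.fourierTransformCLM ℂ (fiber z.1 h)) k ((2 * Real.pi)⁻¹ • z.2)
  have h2 := hC (fiber z.1 h)
  have h3 : s.sup (schwartzSeminormFamily ℂ (Conf n) G) (fiber z.1 h) ≤
      s.sup (schwartzSeminormFamily ℂ (Conf n × Conf n) G) h := by
    refine Seminorm.finset_sup_apply_le (apply_nonneg _ _) fun i hi => ?_
    exact (seminorm_fiber_le z.1 h i.1 i.2).trans
      (Seminorm.le_finset_sup_apply (p := schwartzSeminormFamily ℂ (Conf n × Conf n) G) hi)
  rw [← partialFourierFun_eq_fourier, norm_smul, mul_pow, norm_inv, Real.norm_of_nonneg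
    Real.two_pi_pos.le] at h1
  have h4 : ((2 * Real.pi)⁻¹ ^ k * ‖z.2‖ ^ k) * ‖partialFourierFun h z‖ ≤
      C * s.sup (schwartzSeminormFamily ℂ (Conf n × Conf n) G) h := by
    refine h1.trans (h2.trans ?_)
    exact mul_le_mul_of_nonneg_left h3 C.2
  have h5 : (0 : ℝ) < (2 * Real.pi) ^ k := by positivity
  calc ‖z.2‖ ^ k * ‖partialFourierFun h z‖
      = (2 * Real.pi) ^ k * (((2 * Real.pi)⁻¹ ^ k * ‖z.2‖ ^ k) * ‖partialFourierFun h z‖) := by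
        rw [inv_pow]
        field_simp
    _ ≤ _ := by
        rw [mul_assoc ((2 * Real.pi) ^ k) (C : ℝ)]
        exact mul_le_mul_of_nonneg_left h4 h5.le

end PartialFourier

theorem contDiff_partialFourierFun_nat {n : ℕ} (m : ℕ) :
    ∀ (G : Type) [NormedAddCommGroup G] [NormedSpace ℂ G]
      (h : 𝓢(Conf n × Conf n, G)), ContDiff ℝ m (partialFourierFun h) := by
  induction m with
  | zero =>
    intro G _ _ h
    exact contDiff_zero.2 (continuous_iff_continuousAt.2 fun z =>
      (hasFDerivAt_partialFourierFun h z).continuousAt)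
  | succ m ih =>
    intro G _ _ h
    push_cast
    rw [contDiff_succ_iff_fderiv]
    refine ⟨fun z => (hasFDerivAt_partialFourierFun h z).differentiableAt, by simp, ?_⟩
    rw [fderiv_partialFourierFun]
    exact ih _ (amplitudeCLM n G h)

theorem partialFourierFun_bound {n : ℕ} (k m : ℕ) :
    ∀ (G : Type) [NormedAddCommGroup G] [NormedSpace ℂ G],
      ∃ (s : Finset (ℕ × ℕ)) (C : ℝ), 0 ≤ C ∧
        ∀ (h : 𝓢(Conf n × Conf n, G)) (z : Conf n × Conf n),
          ‖z‖ ^ k * ‖iteratedFDeriv ℝ m (partialFourierFun h) z‖ ≤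
            C * s.sup (schwartzSeminormFamily ℂ (Conf n × Conf n) G) h := by
  induction m with
  | zero =>
    intro G _ _
    obtain ⟨s, C, hC, hs⟩ := momentum_decay (n := n) (G := G) k
    have hI : 0 ≤ ∫ ξ : Conf n, weight ξ :=
      MeasureTheory.integral_nonneg fun ξ => Real.rpow_nonneg (by positivity) _
    refine ⟨s ∪ Finset.Iic (k + (n + 1), 0), C + 2 ^ (k + (n + 1)) * (∫ ξ : Conf n, weight ξ),
      by positivity, fun h z => ?_⟩
    rw [norm_iteratedFDeriv_zero]
    have e1 : s.sup (schwartzSeminormFamily ℂ (Conf n × Conf n) G) h ≤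
        (s ∪ Finset.Iic (k + (n + 1), 0)).sup
          (schwartzSeminormFamily ℂ (Conf n × Conf n) G) h :=
      Finset.sup_mono (f := schwartzSeminormFamily ℂ (Conf n × Conf n) G)
        Finset.subset_union_left h
    have e2 : (Finset.Iic (k + (n + 1), 0)).sup (schwartzSeminormFamily ℂ (Conf n × Conf n) G) h ≤
        (s ∪ Finset.Iic (k + (n + 1), 0)).sup
          (schwartzSeminormFamily ℂ (Conf n × Conf n) G) h :=
      Finset.sup_mono (f := schwartzSeminormFamily ℂ (Conf n × Conf n) G)
        Finset.subset_union_right h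
    have d1 := (hs h z).trans (mul_le_mul_of_nonneg_left e1 hC)
    have d2 := (position_decay k h z).trans (mul_le_mul_of_nonneg_left e2 (by positivity))
    have hz : ‖z‖ ^ k ≤ ‖z.1‖ ^ k + ‖z.2‖ ^ k := by
      rw [Prod.norm_def]
      rcases max_cases ‖z.1‖ ‖z.2‖ with ⟨h, -⟩ | ⟨h, -⟩ <;> rw [h]
      · exact le_add_of_nonneg_right (by positivity)
      · exact le_add_of_nonneg_left (by positivity)
    have d3 := mul_le_mul_of_nonneg_right hz (norm_nonneg (partialFourierFun h z))
    linarith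
  | succ m ih =>
    intro G _ _
    obtain ⟨s, C, hC, hs⟩ := ih ((Conf n × Conf n) →L[ℝ] G)
    let p : ℕ × ℕ → Seminorm ℂ 𝓢(Conf n × Conf n, (Conf n × Conf n) →L[ℝ] G) :=
      schwartzSeminormFamily ℂ (Conf n × Conf n) ((Conf n × Conf n) →L[ℝ] G)
    have hp : Continuous (s.sup p : Seminorm ℂ 𝓢(Conf n × Conf n, (Conf n × Conf n) →L[ℝ] G)) :=
      Seminorm.continuous_finsetSup fun i _ =>
        (schwartz_withSeminorms ℂ (Conf n × Conf n) ((Conf n × Conf n) →L[ℝ] G)).continuous_seminorm i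
    obtain ⟨s', C', -, hC'⟩ := Seminorm.bound_of_continuous
      (schwartz_withSeminorms ℂ (Conf n × Conf n) G)
      ((s.sup p).comp (amplitudeCLM n G).toLinearMap) (hp.comp (amplitudeCLM n G).continuous)
    refine ⟨s', C * C', by positivity, fun h z => ?_⟩
    rw [← norm_iteratedFDeriv_fderiv, fderiv_partialFourierFun]
    refine (hs (amplitudeCLM n G h) z).trans ?_
    rw [mul_assoc]
    exact mul_le_mul_of_nonneg_left (hC' h) hC

/-- The partial Fourier transform `I ⊗ 𝓕` as a continuous linear operator on `S(ℝ²ⁿ)`. -/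
def partialFourierCLM (n : ℕ) : 𝓢(Conf n × Conf n, ℂ) →L[ℂ] 𝓢(Conf n × Conf n, ℂ) :=
  SchwartzMap.mkCLM (fun h => partialFourierFun h)
    (fun h g z => by
      simp only [partialFourierFun, _root_.add_apply, smul_add]
      exact MeasureTheory.integral_add (integrable_integrand h z) (integrable_integrand g z))
    (fun a h z => by
      simp only [partialFourierFun, _root_.smul_apply, RingHom.id_apply]
      rw [← MeasureTheory.integral_smul]
      congr 1
      ext ξ
      exact smul_comm _ _ _)
    (fun h => contDiff_infty.2 fun m => contDiff_partialFourierFun_nat m ℂ h)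
    (fun km => partialFourierFun_bound km.1 km.2 ℂ)

theorem partialFourierCLM_apply {n : ℕ} (h : 𝓢(Conf n × Conf n, ℂ)) (x η : Conf n) :
    partialFourierCLM n h (x, η) =
      ∫ ξ : Conf n, Complex.exp (-(Complex.I * ((inner ℝ ξ η : ℝ) : ℂ))) * h (x, ξ) := rfl

/-! ### Weyl quantization -/

/-- The volume preserving linear change of variables `(x, y) ↦ ((x + y) / 2, y - x)`. -/
def midpointEquiv (n : ℕ) : (Conf n × Conf n) ≃L[ℝ] (Conf n × Conf n) :=
  ContinuousLinearEquiv.equivOfInverse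
    (((2⁻¹ : ℝ) • ContinuousLinearMap.fst ℝ (Conf n) (Conf n) +
        (2⁻¹ : ℝ) • ContinuousLinearMap.snd ℝ (Conf n) (Conf n)).prod
      (ContinuousLinearMap.snd ℝ (Conf n) (Conf n) -
        ContinuousLinearMap.fst ℝ (Conf n) (Conf n)))
    ((ContinuousLinearMap.fst ℝ (Conf n) (Conf n) -
        (2⁻¹ : ℝ) • ContinuousLinearMap.snd ℝ (Conf n) (Conf n)).prod
      (ContinuousLinearMap.fst ℝ (Conf n) (Conf n) +
        (2⁻¹ : ℝ) • ContinuousLinearMap.snd ℝ (Conf n) (Conf n)))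
    (by
      rintro ⟨x, y⟩
      ext i <;> simp <;> ring)
    (by
      rintro ⟨q, p⟩
      ext i <;> simp <;> ring)

/-- The partial Fourier transform on tempered distributions, `((I ⊗ 𝓕) T)(h) = T ((I ⊗ 𝓕) h)`. -/
def partialFourierDistribution {n : ℕ} (T : 𝓢'(Conf n × Conf n, ℂ)) : 𝓢'(Conf n × Conf n, ℂ) :=
  PointwiseConvergenceCLM.precomp ℂ (partialFourierCLM n) T

/-- The change of variables `(x, y) ↦ ((x + y) / 2, y - x)` in a tempered distribution.  As this
map `χ` preserves the volume, the extension of `T ↦ T ∘ χ` from functions to distributions is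
`(T ∘ χ)(g) = T (g ∘ χ⁻¹)`. -/
def compMidpoint {n : ℕ} (T : 𝓢'(Conf n × Conf n, ℂ)) : 𝓢'(Conf n × Conf n, ℂ) :=
  PointwiseConvergenceCLM.precomp ℂ
    (SchwartzMap.compCLMOfContinuousLinearEquiv ℂ (midpointEquiv n).symm) T

/-- The kernel `K_f(x, y) = ((I ⊗ 𝓕) f)((x + y) / 2, y - x)` of the Weyl operator with symbol
`f`. -/
def weylKernel {n : ℕ} (f : 𝓢'(Conf n × Conf n, ℂ)) : 𝓢'(Conf n × Conf n, ℂ) :=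
  compMidpoint (partialFourierDistribution f)

/-- The Weyl operator `Op(f) : S(ℝⁿ) → S'(ℝⁿ)`, `Op(f) u (v) = K_f (v ⊗ u)`. -/
def weylOp {n : ℕ} (f : 𝓢'(Conf n × Conf n, ℂ)) : 𝓢(Conf n, ℂ) →L[ℂ] 𝓢'(Conf n, ℂ) where
  toFun u := ContinuousLinearMap.toPointwiseConvergenceCLM _ _ _ _
    ((weylKernel f).comp (tensorLeftCLM u))
  map_add' u w := by
    ext v
    exact map_add ((weylKernel f).comp (tensorRightCLM v)) u w
  map_smul' a u := by
    ext v
    exact map_smul ((weylKernel f).comp (tensorRightCLM v)) a u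
  cont := PointwiseConvergenceCLM.continuous_of_continuous_eval fun v =>
    ((weylKernel f).comp (tensorRightCLM v)).continuous

theorem weylOp_apply {n : ℕ} (f : 𝓢'(Conf n × Conf n, ℂ)) (u v : 𝓢(Conf n, ℂ)) :
    weylOp f u v = weylKernel f (tensorLeftCLM u v) := rfl

end

end WeylHO

/-!
A Weyl operator acts by `Op(f) u (v) = f (wigner v u)`, where `wigner v u` is the cross-Wigner
transform.  Let `H = ‖x‖² - Δ` be twice the quantum harmonic oscillator.  If `H v = l v` and
`H u = m u`, then a computation in midpoint coordinates shows that the Hamiltonian vector field of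
`(‖x‖² + ‖ξ‖²) / 2` multiplies `wigner v u` by `i (m - l) / 2`, so that `wigner v u ∘ φ_t` is
`exp (i (m - l) t / 2)` times `wigner v u` (`wigner_flow`).  For a constant of motion `f` this forces
`Op(f) u (v) = 0` as soon as `l ≠ m` (`weylOp_eq_zero_of_ne`): the operator is block diagonal with
respect to the eigenspaces of `H`.

The rest is the Hermite description of Schwartz space.  The ladder operators `x_j ± ∂_j` shift
eigenvalues of `H` by `∓ 2`, and `‖x_j g‖², ‖∂_j g‖² ≤ ⟨g, H g⟩`; together with a Sobolev inequality
this bounds every Schwartz seminorm of an eigenfunction by its `L²` norm times a power of the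
eigenvalue (`tame_seminorm`).  The spaces `hermiteSpace n m`, obtained from the Gaussian by `m`
creation operators, are finite-dimensional, mutually orthogonal, and complete
(`eq_zero_of_inner_eq_zero`), so every Schwartz function is the sum of its projections, which
decrease rapidly and converge in Schwartz space (`hasSum_hermiteProj`).  Conversely any rapidly
decreasing sequence of Hermite functions sums to a Schwartz function.

Finally, `Op(f)` is bounded on the `m`-th block by a fixed power of `m`, since `f` is tempered.
Block diagonality therefore makes the blocks of `Op(f) u` decrease rapidly along with those of `u`
(`rapidlyDecreasing_block`), and their sum is a Schwartz function representing `Op(f) u`.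
-/

namespace WeylHO

noncomputable section

open MeasureTheory
open scoped LineDeriv FourierTransform

variable {n : ℕ}

/-! ### The oscillator algebra on Schwartz space -/

/-- Multiplication by the `j`-th coordinate. -/
def posOp (j : Fin n) : 𝓢(Conf n, ℂ) →L[ℂ] 𝓢(Conf n, ℂ) :=
  SchwartzMap.smulLeftCLM ℂ (fun x : Conf n => ((x j : ℝ) : ℂ))

/-- The partial derivative in the `j`-th coordinate. -/
def derivOp (j : Fin n) : 𝓢(Conf n, ℂ) →L[ℂ] 𝓢(Conf n, ℂ) :=
  LineDeriv.lineDerivOpCLM ℂ 𝓢(Conf n, ℂ) (EuclideanSpace.single j (1 : ℝ))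

/-- The Hermite operator `‖x‖² - Δ`, which is twice the quantum harmonic oscillator. -/
def hermiteOp (n : ℕ) : 𝓢(Conf n, ℂ) →L[ℂ] 𝓢(Conf n, ℂ) :=
  ∑ j, (posOp j * posOp j - derivOp j * derivOp j)

/-- The annihilation operator `x_j + ∂_j`. -/
def annihilationOp (j : Fin n) : 𝓢(Conf n, ℂ) →L[ℂ] 𝓢(Conf n, ℂ) := posOp j + derivOp j

/-- The creation operator `x_j - ∂_j`. -/
def creationOp (j : Fin n) : 𝓢(Conf n, ℂ) →L[ℂ] 𝓢(Conf n, ℂ) := posOp j - derivOp j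

theorem hasTemperateGrowth_coord (j : Fin n) :
    Function.HasTemperateGrowth (fun x : Conf n => ((x j : ℝ) : ℂ)) :=
  (Complex.ofRealCLM.comp (EuclideanSpace.proj (𝕜 := ℝ) j)).hasTemperateGrowth

theorem posOp_apply (j : Fin n) (g : 𝓢(Conf n, ℂ)) (x : Conf n) :
    posOp j g x = ((x j : ℝ) : ℂ) * g x :=
  SchwartzMap.smulLeftCLM_apply_apply (hasTemperateGrowth_coord j) g x

theorem derivOp_eq (j : Fin n) (g : 𝓢(Conf n, ℂ)) :
    derivOp j g = ∂_{EuclideanSpace.single j (1 : ℝ)} g := rfl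

theorem derivOp_apply (j : Fin n) (g : 𝓢(Conf n, ℂ)) (x : Conf n) :
    derivOp j g x = fderiv ℝ g x (EuclideanSpace.single j 1) := rfl

theorem hermiteOp_apply (g : 𝓢(Conf n, ℂ)) :
    hermiteOp n g = ∑ j, (posOp j (posOp j g) - derivOp j (derivOp j g)) := by
  simp [hermiteOp]

theorem clm_mul_apply {V : Type*} [AddCommGroup V] [Module ℂ V] [TopologicalSpace V]
    (B C : V →L[ℂ] V) (g : V) : (B * C) g = B (C g) := rfl

theorem posOp_mul_comm (i j : Fin n) : posOp i * posOp j = posOp j * posOp i := by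
  ext g x
  simp only [clm_mul_apply, posOp_apply]
  ring

theorem derivOp_mul_comm (i j : Fin n) : derivOp i * derivOp j = derivOp j * derivOp i := by
  ext g x
  have hsymm : IsSymmSndFDerivAt ℝ g x :=
    ((g.smooth 2).contDiffAt (x := x)).isSymmSndFDerivAt (by simp)
  have key : ∀ i j : Fin n, derivOp i (derivOp j g) x =
      fderiv ℝ (fderiv ℝ g) x (EuclideanSpace.single i 1) (EuclideanSpace.single j 1) := by
    intro i j
    have h2 : DifferentiableAt ℝ (fderiv ℝ g) x :=
      (SchwartzMap.fderivCLM ℂ (Conf n) ℂ g).differentiableAt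
    rw [derivOp_apply]
    change fderiv ℝ (fun y => fderiv ℝ g y (EuclideanSpace.single j 1)) x _ = _
    rw [fderiv_clm_apply h2 (differentiableAt_const _)]
    simp
  simp only [clm_mul_apply, key]
  exact hsymm _ _

theorem derivOp_mul_posOp (i j : Fin n) :
    derivOp i * posOp j = posOp j * derivOp i + if i = j then 1 else 0 := by
  ext g x
  have h1 : HasFDerivAt (fun y : Conf n => ((y j : ℝ) : ℂ))
      (Complex.ofRealCLM.comp (EuclideanSpace.proj (𝕜 := ℝ) j)) x :=
    (Complex.ofRealCLM.comp (EuclideanSpace.proj (𝕜 := ℝ) j)).hasFDerivAt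
  have h2 := h1.mul (g.hasFDerivAt x)
  have h3 : (posOp j g : Conf n → ℂ) = fun y => ((y j : ℝ) : ℂ) * g y :=
    funext fun y => posOp_apply j g y
  have h4 : derivOp i (posOp j g) x =
      ((x j : ℝ) : ℂ) * derivOp i g x + g x * (((EuclideanSpace.single i (1 : ℝ) : Conf n) j : ℝ) : ℂ) := by
    rw [derivOp_apply, h3]
    change fderiv ℝ ((fun y : Conf n => ((y j : ℝ) : ℂ)) * (g : Conf n → ℂ)) x _ = _
    rw [h2.fderiv]
    rfl
  simp only [clm_mul_apply, h4, _root_.add_apply, posOp_apply]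
  rcases eq_or_ne i j with rfl | hij
  · simp
  · simp [hij, hij.symm]

/-- The commutator of `x² - d²` with `x' + ε d'` in a ring with canonical commutation relations
`[d, x'] = [d', x] = δ`, for central `δ` and `ε`. -/
theorem sq_sub_sq_mul_add {R : Type*} [Ring R] (x d x' d' : R) (δ : R) (hx : x * x' = x' * x)
    (hd : d * d' = d' * d) (h1 : d * x' = x' * d + δ) (h2 : d' * x = x * d' + δ)
    (hδ : ∀ y, δ * y = y * δ) (ε : R) (hε : ∀ y, ε * y = y * ε) :
    (x * x - d * d) * (x' + ε * d') =
      (x' + ε * d') * (x * x - d * d) - 2 * δ * (ε * x + d) := by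
  have a1 : x * x * x' = x' * x * x := by rw [mul_assoc, hx, ← mul_assoc, hx]
  have a2 : d * d * d' = d' * d * d := by rw [mul_assoc, hd, ← mul_assoc, hd]
  have a3 : d * d * x' = x' * d * d + 2 * δ * d := by
    rw [mul_assoc, h1, mul_add, ← mul_assoc, h1, ← hδ]
    noncomm_ring
  have a4 : x * x * d' = d' * x * x - 2 * δ * x := by
    have e : x * d' = d' * x - δ := by rw [h2]; abel
    rw [mul_assoc, e, mul_sub, ← mul_assoc, e, ← hδ]
    noncomm_ring
  have a5 : x * x * (ε * d') = ε * (x * x * d') := by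
    rw [← mul_assoc, ← hε]; noncomm_ring
  have a6 : d * d * (ε * d') = ε * (d * d * d') := by
    rw [← mul_assoc, ← hε]; noncomm_ring
  have a7 : 2 * δ * (ε * x) = ε * (2 * δ * x) := by
    rw [← mul_assoc, ← hε]; noncomm_ring
  rw [sub_mul, mul_add, mul_add, a5, a6, mul_add, a7, a1, a2, a3, a4]
  noncomm_ring

/-- `[H, x_j + ε ∂_j] = -2 (ε x_j + ∂_j)`.  For `ε = ±1` the right-hand side is a multiple of
`x_j + ε ∂_j`, which gives the ladder relations. -/
theorem hermiteOp_mul_posOp_add_derivOp (j : Fin n) (ε : ℂ) :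
    hermiteOp n * (posOp j + ε • derivOp j) =
      (posOp j + ε • derivOp j) * hermiteOp n - (2 : ℂ) • (ε • posOp j + derivOp j) := by
  have key : ∀ i : Fin n, (posOp i * posOp i - derivOp i * derivOp i) *
      (posOp j + ε • derivOp j) =
      (posOp j + ε • derivOp j) * (posOp i * posOp i - derivOp i * derivOp i) -
        if i = j then (2 : ℂ) • (ε • posOp j + derivOp j) else 0 := by
    intro i
    have h := sq_sub_sq_mul_add (posOp i) (derivOp i) (posOp j) (derivOp j)
      (if i = j then 1 else 0) (posOp_mul_comm i j) (derivOp_mul_comm i j) (derivOp_mul_posOp i j)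
      (by rw [derivOp_mul_posOp j i]; simp only [eq_comm]) (by intro y; split_ifs <;> simp)
      (ε • 1) (by intro y; simp)
    simp only [smul_mul_assoc, one_mul] at h
    rw [h]
    congr 1
    split_ifs with hij
    · subst hij
      rw [mul_one, two_mul, two_smul]
    · simp
  rw [hermiteOp, Finset.sum_mul, Finset.mul_sum, Finset.sum_congr rfl fun i _ => key i,
    Finset.sum_sub_distrib]
  simp

theorem hermiteOp_annihilationOp (j : Fin n) (g : 𝓢(Conf n, ℂ)) :
    hermiteOp n (annihilationOp j g) =
      annihilationOp j (hermiteOp n g) - (2 : ℂ) • annihilationOp j g := by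
  have h := congrArg (fun B => B g) (hermiteOp_mul_posOp_add_derivOp j 1)
  simpa [annihilationOp] using h

theorem hermiteOp_creationOp (j : Fin n) (g : 𝓢(Conf n, ℂ)) :
    hermiteOp n (creationOp j g) =
      creationOp j (hermiteOp n g) + (2 : ℂ) • creationOp j g := by
  have h := congrArg (fun B => B g) (hermiteOp_mul_posOp_add_derivOp j (-1))
  have e : creationOp j = posOp j + (-1 : ℂ) • derivOp j := by
    rw [creationOp, neg_one_smul, sub_eq_add_neg]
  rw [e]
  refine Eq.trans h ?_
  simp only [_root_.sub_apply, clm_mul_apply, _root_.smul_apply,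
    _root_.add_apply]
  module

theorem annihilationOp_creationOp (i j : Fin n) (g : 𝓢(Conf n, ℂ)) :
    annihilationOp i (creationOp j g) =
      creationOp j (annihilationOp i g) + if i = j then (2 : ℂ) • g else 0 := by
  have hx := congrArg (fun B => B g) (posOp_mul_comm i j)
  have hd := congrArg (fun B => B g) (derivOp_mul_comm i j)
  have h1 := congrArg (fun B => B g) (derivOp_mul_posOp i j)
  have h2 := congrArg (fun B => B g) (derivOp_mul_posOp j i)
  simp only [clm_mul_apply, _root_.add_apply] at hx hd h1 h2
  simp only [annihilationOp, creationOp, _root_.add_apply, _root_.sub_apply, map_add, map_sub,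
    hx, hd, h1, h2]
  rcases eq_or_ne i j with rfl | hij
  · simp
    module
  · simp [hij, hij.symm]
    abel

theorem posOp_eq (j : Fin n) (g : 𝓢(Conf n, ℂ)) :
    posOp j g = (1 / 2 : ℂ) • (annihilationOp j g + creationOp j g) := by
  simp only [annihilationOp, creationOp, _root_.add_apply, _root_.sub_apply]
  module

theorem derivOp_eq_sub (j : Fin n) (g : 𝓢(Conf n, ℂ)) :
    derivOp j g = (1 / 2 : ℂ) • (annihilationOp j g - creationOp j g) := by
  simp only [annihilationOp, creationOp, _root_.add_apply, _root_.sub_apply]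
  module

/-! ### The `L²` inner product -/

/-- The embedding of Schwartz space into `L²`. -/
def toL2 (n : ℕ) : 𝓢(Conf n, ℂ) →L[ℂ] Lp ℂ 2 (volume : Measure (Conf n)) :=
  SchwartzMap.toLpCLM ℂ ℂ 2 volume

theorem toL2_injective : Function.Injective (toL2 n) :=
  SchwartzMap.injective_toLp 2 volume

theorem inner_toL2 (f g : 𝓢(Conf n, ℂ)) :
    inner ℂ (toL2 n f) (toL2 n g) = ∫ x, inner ℂ (f x) (g x) :=
  SchwartzMap.inner_toL2_toL2_eq f g

theorem inner_posOp (j : Fin n) (f g : 𝓢(Conf n, ℂ)) :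
    inner ℂ (toL2 n (posOp j f)) (toL2 n g) = inner ℂ (toL2 n f) (toL2 n (posOp j g)) := by
  rw [inner_toL2, inner_toL2]
  congr 1
  ext x
  simp [posOp_apply]
  ring

theorem inner_derivOp (j : Fin n) (f g : 𝓢(Conf n, ℂ)) :
    inner ℂ (toL2 n (derivOp j f)) (toL2 n g) = -inner ℂ (toL2 n f) (toL2 n (derivOp j g)) := by
  rw [inner_toL2, inner_toL2]
  have h := SchwartzMap.integral_bilinear_lineDerivOp_right_eq_neg_left (μ := volume) f g
    ((ContinuousLinearMap.mul ℝ ℂ).comp (Complex.conjCLE : ℂ →L[ℝ] ℂ)) (EuclideanSpace.single j 1)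
  simp only [ContinuousLinearMap.comp_apply, ContinuousLinearMap.mul_apply',
    ContinuousLinearEquiv.coe_coe, Complex.conjCLE_apply] at h
  simp only [RCLike.inner_apply', derivOp_eq]
  rw [h, neg_neg]

theorem inner_hermiteOp (f g : 𝓢(Conf n, ℂ)) :
    inner ℂ (toL2 n (hermiteOp n f)) (toL2 n g) = inner ℂ (toL2 n f) (toL2 n (hermiteOp n g)) := by
  simp only [hermiteOp_apply, map_sum, map_sub, sum_inner, inner_sum, inner_sub_left,
    inner_sub_right, inner_posOp, inner_derivOp, neg_neg]

theorem inner_hermiteOp_self (g : 𝓢(Conf n, ℂ)) :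
    inner ℂ (toL2 n g) (toL2 n (hermiteOp n g)) =
      ((∑ j, (‖toL2 n (posOp j g)‖ ^ 2 + ‖toL2 n (derivOp j g)‖ ^ 2) : ℝ) : ℂ) := by
  simp only [hermiteOp_apply, map_sum, map_sub, inner_sum, inner_sub_right]
  push_cast
  refine Finset.sum_congr rfl fun j _ => ?_
  have h := inner_derivOp j g (derivOp j g)
  rw [inner_self_eq_norm_sq_to_K] at h
  rw [← inner_posOp, inner_self_eq_norm_sq_to_K, sub_eq_add_neg, ← h]
  rfl

/-- On an eigenvector the nonnegative terms `‖x_j g‖²` and `‖∂_j g‖²` add up to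
`⟨g, H g⟩ = l ‖g‖²`. -/
theorem norm_posOp_derivOp_le (l : ℝ) (g : 𝓢(Conf n, ℂ)) (hg : hermiteOp n g = (l : ℂ) • g)
    (j : Fin n) : ‖toL2 n (posOp j g)‖ ≤ (1 + |l|) * ‖toL2 n g‖ ∧
      ‖toL2 n (derivOp j g)‖ ≤ (1 + |l|) * ‖toL2 n g‖ := by
  have h := inner_hermiteOp_self g
  rw [hg, map_smul, inner_smul_right, inner_self_eq_norm_sq_to_K] at h
  have h' : l * ‖toL2 n g‖ ^ 2 =
      ∑ j, (‖toL2 n (posOp j g)‖ ^ 2 + ‖toL2 n (derivOp j g)‖ ^ 2) := by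
    apply Complex.ofReal_injective
    rw [← h]
    push_cast
    rfl
  have h1 : ‖toL2 n (posOp j g)‖ ^ 2 + ‖toL2 n (derivOp j g)‖ ^ 2 ≤ l * ‖toL2 n g‖ ^ 2 := by
    rw [h']
    exact Finset.single_le_sum
      (f := fun j => ‖toL2 n (posOp j g)‖ ^ 2 + ‖toL2 n (derivOp j g)‖ ^ 2)
      (fun i _ => by positivity) (Finset.mem_univ j)
  have h2 : l * ‖toL2 n g‖ ^ 2 ≤ ((1 + |l|) * ‖toL2 n g‖) ^ 2 := by
    rw [mul_pow]
    refine mul_le_mul_of_nonneg_right ?_ (by positivity)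
    nlinarith [le_abs_self l, abs_nonneg l]
  have h3 : 0 ≤ (1 + |l|) * ‖toL2 n g‖ := by positivity
  constructor
  · refine (pow_le_pow_iff_left₀ (norm_nonneg _) h3 two_ne_zero).1 ?_
    nlinarith [sq_nonneg ‖toL2 n (derivOp j g)‖]
  · refine (pow_le_pow_iff_left₀ (norm_nonneg _) h3 two_ne_zero).1 ?_
    nlinarith [sq_nonneg ‖toL2 n (posOp j g)‖]

/-! ### Wigner transforms of eigenfunctions along the flow -/

/-- The Schwartz function `v ⊗ u` in midpoint coordinates `(q, p)`, with `q = (x + y) / 2` and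
`p = y - x`. -/
def midpointTensor (v u : 𝓢(Conf n, ℂ)) : 𝓢(Conf n × Conf n, ℂ) :=
  SchwartzMap.compCLMOfContinuousLinearEquiv ℂ (midpointEquiv n).symm (tensorLeftCLM u v)

theorem midpointTensor_apply (v u : 𝓢(Conf n, ℂ)) (z : Conf n × Conf n) :
    midpointTensor v u z = v (z.1 - (2⁻¹ : ℝ) • z.2) * u (z.1 + (2⁻¹ : ℝ) • z.2) := rfl

/-- The (unnormalized) cross-Wigner transform, through which a Weyl symbol acts:
`Op(f) u (v) = f (wigner v u)`. -/
def wigner (v u : 𝓢(Conf n, ℂ)) : 𝓢(Conf n × Conf n, ℂ) :=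
  partialFourierCLM n (midpointTensor v u)

theorem weylOp_eq_wigner (f : 𝓢'(Conf n × Conf n, ℂ)) (u v : 𝓢(Conf n, ℂ)) :
    weylOp f u v = f (wigner v u) := rfl

theorem lineDerivOp_tensorLeftCLM (a b : Conf n) (v u : 𝓢(Conf n, ℂ)) :
    ∂_{(a, b)} (tensorLeftCLM u v) = tensorLeftCLM u (∂_{a} v) + tensorLeftCLM (∂_{b} u) v := by
  ext z
  have h1 : HasFDerivAt (fun z : Conf n × Conf n => v z.1) _ z :=
    HasFDerivAt.comp (g := v) z (v.hasFDerivAt z.1) (hasFDerivAt_fst (𝕜 := ℝ) (p := z))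
  have h2 : HasFDerivAt (fun z : Conf n × Conf n => u z.2) _ z :=
    HasFDerivAt.comp (g := u) z (u.hasFDerivAt z.2) (hasFDerivAt_snd (𝕜 := ℝ) (p := z))
  have h3 : HasFDerivAt (tensorLeftCLM u v) _ z := h1.mul h2
  rw [SchwartzMap.lineDerivOp_apply_eq_fderiv, h3.fderiv]
  simp only [_root_.add_apply, tensorLeftCLM_apply, SchwartzMap.lineDerivOp_apply_eq_fderiv,
    _root_.smul_apply, ContinuousLinearMap.comp_apply, ContinuousLinearMap.coe_fst',
    ContinuousLinearMap.coe_snd', smul_eq_mul]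
  ring

/-- A momentum derivative becomes multiplication by `i ξ` under the partial Fourier transform. -/
theorem partialFourierCLM_lineDerivOp (e : Conf n) (F : 𝓢(Conf n × Conf n, ℂ))
    (z : Conf n × Conf n) :
    partialFourierCLM n (∂_{((0, e) : Conf n × Conf n)} F) z =
      Complex.I * ((inner ℝ z.2 e : ℝ) : ℂ) * partialFourierCLM n F z := by
  have hfib : fiber z.1 (∂_{((0, e) : Conf n × Conf n)} F) = ∂_{e} (fiber z.1 F) := by
    ext ξ
    have hg : HasFDerivAt (fun ξ : Conf n => (z.1, ξ))
        (ContinuousLinearMap.inr ℝ (Conf n) (Conf n)) ξ :=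
      hasFDerivAt_prodMk_right z.1 ξ
    have h1 : HasFDerivAt (fiber z.1 F) _ ξ :=
      HasFDerivAt.comp (g := F) ξ (F.hasFDerivAt (z.1, ξ)) hg
    rw [SchwartzMap.lineDerivOp_apply_eq_fderiv, h1.fderiv]
    rfl
  have h (G : 𝓢(Conf n × Conf n, ℂ)) : partialFourierCLM n G z =
      SchwartzMap.fourierTransformCLM ℂ (fiber z.1 G) ((2 * Real.pi)⁻¹ • z.2) :=
    partialFourierFun_eq_fourier G z
  have hte : (inner ℝ · e : Conf n → ℝ).HasTemperateGrowth := by fun_prop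
  rw [h, h, hfib, SchwartzMap.fourierTransformCLM_apply, SchwartzMap.fourier_lineDerivOp_eq,
    SchwartzMap.fourierTransformCLM_apply, _root_.smul_apply,
    SchwartzMap.smulLeftCLM_apply_apply hte, real_inner_smul_left, smul_eq_mul,
    Complex.real_smul]
  have := Real.pi_ne_zero
  push_cast
  field_simp

theorem sum_derivOp_derivOp_apply {l : ℂ} {g : 𝓢(Conf n, ℂ)} (hg : hermiteOp n g = l • g)
    (x : Conf n) : ∑ j, derivOp j (derivOp j g) x = (((‖x‖ ^ 2 : ℝ) : ℂ) - l) * g x := by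
  have h := congrArg (fun F : 𝓢(Conf n, ℂ) => F x) hg
  simp only [hermiteOp_apply, _root_.sum_apply, _root_.sub_apply, posOp_apply,
    Finset.sum_sub_distrib, _root_.smul_apply, smul_eq_mul] at h
  rw [EuclideanSpace.norm_sq_eq, sub_mul, ← h]
  push_cast
  rw [Finset.sum_mul]
  simp only [Real.norm_eq_abs, ← Complex.ofReal_pow, sq_abs]
  push_cast
  simp only [← mul_assoc, ← pow_two]
  ring

theorem midpointEquiv_symm_apply (z : Conf n × Conf n) :
    (midpointEquiv n).symm z = (z.1 - (2⁻¹ : ℝ) • z.2, z.1 + (2⁻¹ : ℝ) • z.2) := rfl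

theorem sum_coord_smul_single (ξ : Conf n) :
    ξ = ∑ j, ξ j • (EuclideanSpace.single j (1 : ℝ) : Conf n) := by
  have h := (EuclideanSpace.basisFun (Fin n) ℝ).sum_repr ξ
  simpa using h.symm

theorem lineDerivOp_eq_sum_fst (ξ : Conf n) (h : 𝓢(Conf n × Conf n, ℂ)) :
    ∂_{((ξ, 0) : Conf n × Conf n)} h =
      ∑ j, ξ j • ∂_{((EuclideanSpace.single j (1 : ℝ), 0) : Conf n × Conf n)} h := by
  ext z
  simp only [_root_.sum_apply, _root_.smul_apply, SchwartzMap.lineDerivOp_apply_eq_fderiv]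
  conv_lhs => rw [sum_coord_smul_single ξ]
  have : ((∑ j, ξ j • (EuclideanSpace.single j (1 : ℝ) : Conf n), 0) : Conf n × Conf n) =
      ∑ j, ξ j • ((EuclideanSpace.single j (1 : ℝ), 0) : Conf n × Conf n) := by
    ext1
    · simp [Prod.fst_sum]
    · simp [Prod.snd_sum]
  rw [this, map_sum]
  simp only [map_smul]

theorem lineDerivOp_midpointTensor (a b : Conf n) (v u : 𝓢(Conf n, ℂ)) :
    ∂_{(a, b)} (midpointTensor v u) = midpointTensor (∂_{a - (2⁻¹ : ℝ) • b} v) u +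
      midpointTensor v (∂_{a + (2⁻¹ : ℝ) • b} u) := by
  unfold midpointTensor
  rw [SchwartzMap.lineDerivOp_compCLMOfContinuousLinearEquiv, midpointEquiv_symm_apply,
    lineDerivOp_tensorLeftCLM, map_add]

theorem mixed_lineDerivOp_midpointTensor (j : Fin n) (v u : 𝓢(Conf n, ℂ)) :
    ∂_{((0, EuclideanSpace.single j (1 : ℝ)) : Conf n × Conf n)}
      (∂_{((EuclideanSpace.single j (1 : ℝ), 0) : Conf n × Conf n)} (midpointTensor v u)) =
      (2⁻¹ : ℝ) • (midpointTensor v (derivOp j (derivOp j u)) -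
        midpointTensor (derivOp j (derivOp j v)) u) := by
  have hn : ∀ (g : 𝓢(Conf n, ℂ)),
      ∂_{(0 : Conf n) - (2⁻¹ : ℝ) • (EuclideanSpace.single j (1 : ℝ) : Conf n)} g =
        -((2⁻¹ : ℝ) • derivOp j g) := by
    intro g
    rw [zero_sub, LineDeriv.lineDerivOp_left_neg, LineDeriv.lineDerivOp_left_smul]
    rfl
  have hp : ∀ (g : 𝓢(Conf n, ℂ)),
      ∂_{(0 : Conf n) + (2⁻¹ : ℝ) • (EuclideanSpace.single j (1 : ℝ) : Conf n)} g =
        (2⁻¹ : ℝ) • derivOp j g := by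
    intro g
    rw [zero_add, LineDeriv.lineDerivOp_left_smul]
    rfl
  rw [lineDerivOp_midpointTensor, LineDeriv.lineDerivOp_add, lineDerivOp_midpointTensor,
    lineDerivOp_midpointTensor, smul_zero, sub_zero, add_zero, ← derivOp_eq, ← derivOp_eq,
    hn, hn, hp, hp]
  ext z
  simp only [_root_.add_apply, _root_.smul_apply, _root_.sub_apply, midpointTensor_apply,
    _root_.neg_apply, Complex.real_smul]
  push_cast
  ring

/-- In midpoint coordinates `‖y‖² - ‖x‖² = 2 ⟨p, q⟩` and `Δ_y - Δ_x = 2 ∑ ∂_{p_j} ∂_{q_j}`. -/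
theorem inner_mul_midpointTensor {l m : ℂ} {v u : 𝓢(Conf n, ℂ)} (hv : hermiteOp n v = l • v)
    (hu : hermiteOp n u = m • u) (q p : Conf n) :
    ((inner ℝ p q : ℝ) : ℂ) * midpointTensor v u (q, p) =
      (m - l) / 2 * midpointTensor v u (q, p) +
      ∑ j, (∂_{((0, EuclideanSpace.single j (1 : ℝ)) : Conf n × Conf n)}
        (∂_{((EuclideanSpace.single j (1 : ℝ), 0) : Conf n × Conf n)} (midpointTensor v u)))
          (q, p) := by
  set x := q - (2⁻¹ : ℝ) • p with hx
  set y := q + (2⁻¹ : ℝ) • p with hy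
  have h1 := sum_derivOp_derivOp_apply hv x
  have h2 := sum_derivOp_derivOp_apply hu y
  simp only [mixed_lineDerivOp_midpointTensor, _root_.smul_apply, _root_.sub_apply,
    midpointTensor_apply, ← hx, ← hy, Complex.real_smul, ← Finset.mul_sum,
    Finset.sum_sub_distrib, ← Finset.sum_mul, h1, h2]
  have h3 : ‖y‖ ^ 2 - ‖x‖ ^ 2 = 2 * inner ℝ p q := by
    rw [hx, hy, norm_add_sq_real, norm_sub_sq_real, real_inner_smul_right, real_inner_comm q p]
    ring
  have h4 : ((inner ℝ p q : ℝ) : ℂ) = (((‖y‖ ^ 2 : ℝ) : ℂ) - ((‖x‖ ^ 2 : ℝ) : ℂ)) / 2 := by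
    rw [← Complex.ofReal_sub, h3]
    push_cast
    ring
  rw [h4]
  push_cast
  ring

/-- The Hamiltonian vector field `ξ ∂_q - q ∂_ξ` acts on the transform of a pair of eigenfunctions
as a scalar. -/
theorem fderiv_wigner {l m : ℂ} {v u : 𝓢(Conf n, ℂ)} (hv : hermiteOp n v = l • v)
    (hu : hermiteOp n u = m • u) (z : Conf n × Conf n) :
    fderiv ℝ (wigner v u) z (z.2, -z.1) = Complex.I * ((m - l) / 2) * wigner v u z := by
  set h := midpointTensor v u with hh
  -- the last two terms of `F` cancel after the partial Fourier transform
  let F : 𝓢(Conf n × Conf n, ℂ) := (Complex.I * ((m - l) / 2)) • h +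
    Complex.I • (∑ j, ∂_{((0, EuclideanSpace.single j (1 : ℝ)) : Conf n × Conf n)}
        (∂_{((EuclideanSpace.single j (1 : ℝ), 0) : Conf n × Conf n)} h)) +
    ∂_{((z.2, 0) : Conf n × Conf n)} h
  have hamp : ∀ p : Conf n, amplitudeCLM n ℂ h (z.1, p) (z.2, -z.1) = F (z.1, p) := by
    intro p
    have h1 := inner_mul_midpointTensor hv hu z.1 p
    rw [← hh] at h1
    simp only [F, amplitudeCLM_apply, _root_.add_apply, _root_.smul_apply, _root_.sum_apply,
      SchwartzMap.lineDerivOp_apply_eq_fderiv _ h, inner_neg_right, smul_eq_mul,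
      Complex.real_smul, Complex.ofReal_neg]
    linear_combination Complex.I * h1
  have e1 : fderiv ℝ (wigner v u) z (z.2, -z.1) = partialFourierCLM n F z := by
    change fderiv ℝ (partialFourierFun h) z _ = partialFourierFun F z
    rw [fderiv_partialFourierFun]
    unfold partialFourierFun
    rw [ContinuousLinearMap.integral_apply (integrable_integrand (amplitudeCLM n ℂ h) z)]
    congr 1
    ext p
    rw [_root_.smul_apply, hamp]
  have e2 : ∀ j : Fin n, partialFourierCLM n
      (∂_{((0, EuclideanSpace.single j (1 : ℝ)) : Conf n × Conf n)}
        (∂_{((EuclideanSpace.single j (1 : ℝ), 0) : Conf n × Conf n)} h)) z =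
      Complex.I * (z.2 j : ℂ) *
        partialFourierCLM n (∂_{((EuclideanSpace.single j (1 : ℝ), 0) : Conf n × Conf n)} h) z := by
    intro j
    rw [partialFourierCLM_lineDerivOp]
    simp [EuclideanSpace.inner_single_right]
  rw [e1]
  simp only [F]
  rw [lineDerivOp_eq_sum_fst]
  simp only [map_add, map_smul, map_sum, _root_.add_apply, _root_.smul_apply, _root_.sum_apply,
    e2, smul_eq_mul]
  have e3 : ∀ (c : ℝ) (G : 𝓢(Conf n × Conf n, ℂ)), partialFourierCLM n (c • G) z =
      (c : ℂ) * partialFourierCLM n G z := by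
    intro c G
    have : c • G = (c : ℂ) • G := by ext; simp
    rw [this, map_smul]
    rfl
  simp only [e3, Finset.mul_sum]
  rw [add_assoc, ← Finset.sum_add_distrib]
  change _ = _ * partialFourierCLM n h z
  rw [add_eq_left]
  refine Finset.sum_eq_zero fun j _ => ?_
  linear_combination (z.2 j : ℂ) * partialFourierCLM n
    (∂_{((EuclideanSpace.single j (1 : ℝ), 0) : Conf n × Conf n)} h) z * Complex.I_mul_I

theorem flow_apply (t : ℝ) (z : Conf n × Conf n) :
    flow n t z = (Real.cos t • z.1 + Real.sin t • z.2, -Real.sin t • z.1 + Real.cos t • z.2) := rfl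

theorem hasDerivAt_flow (t : ℝ) (z : Conf n × Conf n) :
    HasDerivAt (fun t => flow n t z) ((flow n t z).2, -(flow n t z).1) t := by
  have hc := Real.hasDerivAt_cos t
  have hs := Real.hasDerivAt_sin t
  have h := ((hc.smul_const z.1).add (hs.smul_const z.2)).prodMk
    ((hs.neg.smul_const z.1).add (hc.smul_const z.2))
  convert h using 1
  · rfl
  · rw [flow_apply]
    ext1
    · simp
    · simp
      abel

/-- The transform of a pair of eigenfunctions is an eigenvector of the flow. -/
theorem wigner_flow {l m : ℂ} {v u : 𝓢(Conf n, ℂ)} (hv : hermiteOp n v = l • v)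
    (hu : hermiteOp n u = m • u) (t : ℝ) (z : Conf n × Conf n) :
    wigner v u (flow n t z) = Complex.exp (Complex.I * ((m - l) / 2) * t) * wigner v u z := by
  set c := Complex.I * ((m - l) / 2) with hc
  -- along an orbit the transform solves the linear equation `y' = c y`
  have hd : ∀ t : ℝ, HasDerivAt
      (fun t : ℝ => Complex.exp (-(c * t)) * wigner v u (flow n t z)) 0 t := by
    intro t
    have h1 : HasDerivAt (fun t : ℝ => wigner v u (flow n t z)) (c * wigner v u (flow n t z)) t := by
      rw [hc, ← fderiv_wigner hv hu]
      exact HasFDerivAt.comp_hasDerivAt (l := wigner v u) t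
        ((wigner v u).hasFDerivAt (flow n t z)) (hasDerivAt_flow t z)
    have h2 : HasDerivAt (fun t : ℝ => Complex.exp (-(c * t)))
        (Complex.exp (-(c * t)) * -(c * 1)) t :=
      (((Complex.ofRealCLM.hasDerivAt (x := t)).const_mul c).neg).cexp
    refine (h2.mul h1).congr_deriv ?_
    ring
  have h := is_const_of_deriv_eq_zero (fun t => (hd t).differentiableAt) (fun t => (hd t).deriv) t 0
  have h0 : flow n 0 z = z := by simp [flow_apply]
  simp only [h0, Complex.ofReal_zero, mul_zero, neg_zero, Complex.exp_zero, one_mul] at h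
  rw [← h, ← mul_assoc, ← Complex.exp_add, add_neg_cancel, Complex.exp_zero, one_mul]

/-- The Weyl operator of a constant of motion has no matrix elements between eigenfunctions of the
harmonic oscillator with different eigenvalues. -/
theorem weylOp_eq_zero_of_ne {f : 𝓢'(Conf n × Conf n, ℂ)} (hf : IsTemperedConstantOfMotion f)
    {l m : ℝ} {v u : 𝓢(Conf n, ℂ)} (hv : hermiteOp n v = (l : ℂ) • v)
    (hu : hermiteOp n u = (m : ℂ) • u) (hlm : l ≠ m) : weylOp f u v = 0 := by
  rw [weylOp_eq_wigner]
  have hml : ((m : ℂ) - l) ≠ 0 := by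
    rw [sub_ne_zero]
    exact_mod_cast hlm.symm
  -- a time at which the flow multiplies the transform by `-1`
  set t : ℝ := 2 * Real.pi / (m - l) with ht
  have h1 : SchwartzMap.compCLMOfContinuousLinearEquiv ℂ (flow n t) (wigner v u) =
      -wigner v u := by
    ext z
    rw [_root_.neg_apply]
    change wigner v u (flow n t z) = _
    rw [wigner_flow hv hu, ht]
    have : Complex.I * (((m : ℂ) - l) / 2) * ((2 * Real.pi / (m - l) : ℝ) : ℂ) =
        Real.pi * Complex.I := by
      push_cast
      field_simp
    rw [this, Complex.exp_pi_mul_I, neg_one_mul]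
  have h2 : flowPullback n t f (wigner v u) = -f (wigner v u) := by
    rw [← map_neg, ← h1]
    rfl
  rw [hf t] at h2
  exact self_eq_neg.1 h2

/-! ### Schwartz seminorms of eigenfunctions -/

/-- A seminorm on Schwartz space is tame if on eigenfunctions of `‖x‖² - Δ` it is bounded by the
`L²` norm, up to a factor of polynomial growth in the eigenvalue. -/
def Tame (p : Seminorm ℂ 𝓢(Conf n, ℂ)) : Prop :=
  ∃ (C : ℝ) (M : ℕ), 0 ≤ C ∧ ∀ (l : ℝ) (g : 𝓢(Conf n, ℂ)), hermiteOp n g = (l : ℂ) • g →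
    p g ≤ C * (1 + |l|) ^ M * ‖toL2 n g‖

/-- The `L²` norm, as a seminorm on Schwartz space. -/
def l2Seminorm (n : ℕ) : Seminorm ℂ 𝓢(Conf n, ℂ) :=
  (normSeminorm ℂ (Lp ℂ 2 (volume : Measure (Conf n)))).comp (toL2 n).toLinearMap

theorem l2Seminorm_apply (g : 𝓢(Conf n, ℂ)) : l2Seminorm n g = ‖toL2 n g‖ := rfl

theorem tame_l2Seminorm : Tame (l2Seminorm n) :=
  ⟨1, 0, zero_le_one, fun l g _ => by simp [l2Seminorm_apply]⟩

theorem Tame.mono {p q : Seminorm ℂ 𝓢(Conf n, ℂ)} (hq : Tame q) (c : ℝ) (hc : 0 ≤ c)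
    (h : ∀ g, p g ≤ c * q g) : Tame p := by
  obtain ⟨C, M, hC, hb⟩ := hq
  refine ⟨c * C, M, by positivity, fun l g hg => (h g).trans ?_⟩
  rw [mul_assoc c, mul_assoc c]
  exact mul_le_mul_of_nonneg_left (hb l g hg) hc

theorem Tame.add {p q : Seminorm ℂ 𝓢(Conf n, ℂ)} (hp : Tame p) (hq : Tame q) : Tame (p + q) := by
  obtain ⟨C, M, hC, hb⟩ := hp
  obtain ⟨C', M', hC', hb'⟩ := hq
  refine ⟨C + C', M + M', by positivity, fun l g hg => ?_⟩
  have h1 : (1 : ℝ) ≤ 1 + |l| := by linarith [abs_nonneg l]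
  have e1 : (1 + |l|) ^ M ≤ (1 + |l|) ^ (M + M') := pow_le_pow_right₀ h1 (by omega)
  have e2 : (1 + |l|) ^ M' ≤ (1 + |l|) ^ (M + M') := pow_le_pow_right₀ h1 (by omega)
  calc (p + q) g = p g + q g := rfl
    _ ≤ C * (1 + |l|) ^ M * ‖toL2 n g‖ + C' * (1 + |l|) ^ M' * ‖toL2 n g‖ :=
      add_le_add (hb l g hg) (hb' l g hg)
    _ ≤ C * (1 + |l|) ^ (M + M') * ‖toL2 n g‖ + C' * (1 + |l|) ^ (M + M') * ‖toL2 n g‖ := by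
      gcongr
    _ = _ := by ring

theorem tame_zero : Tame (0 : Seminorm ℂ 𝓢(Conf n, ℂ)) :=
  ⟨0, 0, le_rfl, fun l g _ => by simp⟩

theorem tame_sum {ι : Type*} (s : Finset ι) (p : ι → Seminorm ℂ 𝓢(Conf n, ℂ))
    (hp : ∀ i ∈ s, Tame (p i)) : Tame (∑ i ∈ s, p i) := by
  classical
  induction s using Finset.induction_on with
  | empty => simpa using tame_zero
  | insert i s hi ih =>
    rw [Finset.sum_insert hi]
    exact (hp i (Finset.mem_insert_self i s)).add
      (ih fun j hj => hp j (Finset.mem_insert_of_mem hj))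

/-- Tameness is preserved by an operator that shifts eigenvalues by a bounded amount. -/
theorem Tame.comp_of_shift {p : Seminorm ℂ 𝓢(Conf n, ℂ)} (hp : Tame p)
    (B : 𝓢(Conf n, ℂ) →L[ℂ] 𝓢(Conf n, ℂ)) (s : ℝ) (hs : |s| ≤ 2)
    (hB : ∀ (l : ℝ) g, hermiteOp n g = (l : ℂ) • g → hermiteOp n (B g) = ((l + s : ℝ) : ℂ) • B g)
    (hn : ∀ (l : ℝ) g, hermiteOp n g = (l : ℂ) • g →
      ‖toL2 n (B g)‖ ≤ 2 * (1 + |l|) * ‖toL2 n g‖) :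
    Tame (p.comp B.toLinearMap) := by
  obtain ⟨C, M, hC, hb⟩ := hp
  refine ⟨C * 3 ^ M * 2, M + 1, by positivity, fun l g hg => ?_⟩
  have h1 : 1 + |l + s| ≤ 3 * (1 + |l|) := by
    linarith [abs_add_le l s, abs_nonneg l]
  calc p (B g) ≤ C * (1 + |l + s|) ^ M * ‖toL2 n (B g)‖ := hb _ _ (hB l g hg)
    _ ≤ C * (3 * (1 + |l|)) ^ M * (2 * (1 + |l|) * ‖toL2 n g‖) := by
      gcongr
      exact hn l g hg
    _ = _ := by rw [mul_pow]; ring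

theorem norm_annihilationOp_le {l : ℝ} {g : 𝓢(Conf n, ℂ)} (hg : hermiteOp n g = (l : ℂ) • g)
    (j : Fin n) : ‖toL2 n (annihilationOp j g)‖ ≤ 2 * (1 + |l|) * ‖toL2 n g‖ := by
  have h := norm_posOp_derivOp_le l g hg j
  have h2 := norm_add_le (toL2 n (posOp j g)) (toL2 n (derivOp j g))
  rw [← map_add] at h2
  refine h2.trans ?_
  linarith [h.1, h.2]

theorem norm_creationOp_le {l : ℝ} {g : 𝓢(Conf n, ℂ)} (hg : hermiteOp n g = (l : ℂ) • g)
    (j : Fin n) : ‖toL2 n (creationOp j g)‖ ≤ 2 * (1 + |l|) * ‖toL2 n g‖ := by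
  have h := norm_posOp_derivOp_le l g hg j
  have h2 := norm_sub_le (toL2 n (posOp j g)) (toL2 n (derivOp j g))
  rw [← map_sub] at h2
  refine h2.trans ?_
  linarith [h.1, h.2]

theorem hermiteOp_annihilationOp_of_eigen {l : ℝ} {g : 𝓢(Conf n, ℂ)}
    (hg : hermiteOp n g = (l : ℂ) • g) (j : Fin n) :
    hermiteOp n (annihilationOp j g) = ((l + -2 : ℝ) : ℂ) • annihilationOp j g := by
  rw [hermiteOp_annihilationOp, hg, map_smul]
  push_cast
  module

theorem hermiteOp_creationOp_of_eigen {l : ℝ} {g : 𝓢(Conf n, ℂ)}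
    (hg : hermiteOp n g = (l : ℂ) • g) (j : Fin n) :
    hermiteOp n (creationOp j g) = ((l + 2 : ℝ) : ℂ) • creationOp j g := by
  rw [hermiteOp_creationOp, hg, map_smul]
  push_cast
  module

theorem Tame.comp_annihilationOp_add_creationOp {p : Seminorm ℂ 𝓢(Conf n, ℂ)} (hp : Tame p)
    (j : Fin n) : Tame (p.comp (annihilationOp j).toLinearMap +
      p.comp (creationOp j).toLinearMap) :=
  (hp.comp_of_shift (annihilationOp j) (-2) (by norm_num)
    (fun _ _ hg => hermiteOp_annihilationOp_of_eigen hg j)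
    (fun _ _ hg => norm_annihilationOp_le hg j)).add
  (hp.comp_of_shift (creationOp j) 2 (by norm_num)
    (fun _ _ hg => hermiteOp_creationOp_of_eigen hg j)
    (fun _ _ hg => norm_creationOp_le hg j))

/-- Multiplication by `x_j` does not preserve eigenfunctions, but it is half the sum of the two ladder
operators, which do. -/
theorem Tame.comp_posOp {p : Seminorm ℂ 𝓢(Conf n, ℂ)} (hp : Tame p) (j : Fin n) :
    Tame (p.comp (posOp j).toLinearMap) := by
  refine (hp.comp_annihilationOp_add_creationOp j).mono (1 / 2) (by norm_num) fun g => ?_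
  change p (posOp j g) ≤ 1 / 2 * (p (annihilationOp j g) + p (creationOp j g))
  rw [posOp_eq, map_smul_eq_mul]
  have := map_add_le_add p (annihilationOp j g) (creationOp j g)
  norm_num
  linarith

theorem Tame.comp_derivOp {p : Seminorm ℂ 𝓢(Conf n, ℂ)} (hp : Tame p) (j : Fin n) :
    Tame (p.comp (derivOp j).toLinearMap) := by
  refine (hp.comp_annihilationOp_add_creationOp j).mono (1 / 2) (by norm_num) fun g => ?_
  change p (derivOp j g) ≤ 1 / 2 * (p (annihilationOp j g) + p (creationOp j g))
  rw [derivOp_eq_sub, map_smul_eq_mul]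
  have := map_sub_le_add p (annihilationOp j g) (creationOp j g)
  norm_num
  linarith

/-- The operator `1 - Δ / (4 π²)`, whose Fourier symbol is `1 + ‖ξ‖²`. -/
def besselOp (n : ℕ) : 𝓢(Conf n, ℂ) →L[ℂ] 𝓢(Conf n, ℂ) :=
  1 - (((2 * Real.pi) ^ 2)⁻¹ : ℂ) • ∑ j, derivOp j * derivOp j

theorem Tame.comp_besselOp {p : Seminorm ℂ 𝓢(Conf n, ℂ)} (hp : Tame p) :
    Tame (p.comp (besselOp n).toLinearMap) := by
  refine (hp.add (tame_sum Finset.univ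
    (fun j : Fin n => (p.comp (derivOp j).toLinearMap).comp (derivOp j).toLinearMap)
    fun j _ => (hp.comp_derivOp j).comp_derivOp j)).mono
      (1 + ‖(((2 * Real.pi) ^ 2)⁻¹ : ℂ)‖) (by positivity) fun g => ?_
  have h1 : besselOp n g = g - (((2 * Real.pi) ^ 2)⁻¹ : ℂ) • ∑ j, derivOp j (derivOp j g) := by
    simp [besselOp, _root_.sum_apply]
  have h2 : (p + ∑ j : Fin n, (p.comp (derivOp j).toLinearMap).comp (derivOp j).toLinearMap) g =
      p g + ∑ j, p (derivOp j (derivOp j g)) := by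
    change p g + (∑ j : Fin n, (p.comp (derivOp j).toLinearMap).comp (derivOp j).toLinearMap) g = _
    rw [_root_.sum_apply]
    rfl
  change p (besselOp n g) ≤ _
  rw [h1, h2]
  have h3 := map_sub_le_add p g ((((2 * Real.pi) ^ 2)⁻¹ : ℂ) • ∑ j, derivOp j (derivOp j g))
  rw [map_smul_eq_mul] at h3
  have h4 : p (∑ j, derivOp j (derivOp j g)) ≤ ∑ j, p (derivOp j (derivOp j g)) :=
    Finset.le_sum_of_subadditive p (map_zero p).le (map_add_le_add p) _ _
  have h5 : 0 ≤ p g := apply_nonneg _ _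
  have h6 : 0 ≤ ∑ j, p (derivOp j (derivOp j g)) :=
    Finset.sum_nonneg fun j _ => apply_nonneg _ _
  have h7 := mul_le_mul_of_nonneg_left h4 (norm_nonneg (((2 * Real.pi) ^ 2)⁻¹ : ℂ))
  have h8 := mul_nonneg (norm_nonneg (((2 * Real.pi) ^ 2)⁻¹ : ℂ)) h5
  rw [one_add_mul, mul_add]
  linarith

theorem Tame.comp_besselOp_pow {p : Seminorm ℂ 𝓢(Conf n, ℂ)} (hp : Tame p) (N : ℕ) :
    Tame (p.comp (besselOp n ^ N).toLinearMap) := by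
  induction N with
  | zero => exact hp
  | succ N ih => exact ih.comp_besselOp

theorem fourier_besselOp_pow_apply (N : ℕ) (g : 𝓢(Conf n, ℂ)) (ξ : Conf n) :
    𝓕 ((besselOp n ^ N) g) ξ = (((1 + ‖ξ‖ ^ 2) ^ N : ℝ) : ℂ) * 𝓕 g ξ := by
  have h1 : ∀ g : 𝓢(Conf n, ℂ), 𝓕 (besselOp n g) ξ = ((1 + ‖ξ‖ ^ 2 : ℝ) : ℂ) * 𝓕 g ξ := by
    intro g
    have hD : ∀ (j : Fin n) (g : 𝓢(Conf n, ℂ)),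
        𝓕 (derivOp j g) ξ = 2 * Real.pi * Complex.I * (ξ j : ℂ) * 𝓕 g ξ := by
      intro j g
      have hte : (inner ℝ · (EuclideanSpace.single j (1 : ℝ)) : Conf n → ℝ).HasTemperateGrowth := by
        fun_prop
      rw [derivOp_eq, SchwartzMap.fourier_lineDerivOp_eq, _root_.smul_apply,
        SchwartzMap.smulLeftCLM_apply_apply hte]
      simp [EuclideanSpace.inner_single_right]
      ring
    have h2 : besselOp n g = g - (((2 * Real.pi) ^ 2)⁻¹ : ℂ) • ∑ j, derivOp j (derivOp j g) := by
      simp [besselOp, _root_.sum_apply]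
    have h3 : 𝓕 (besselOp n g) ξ =
        𝓕 g ξ - (((2 * Real.pi) ^ 2)⁻¹ : ℂ) * ∑ j, 𝓕 (derivOp j (derivOp j g)) ξ := by
      have e := congrArg (fun F : 𝓢(Conf n, ℂ) => SchwartzMap.fourierTransformCLM ℂ F ξ) h2
      simpa only [map_sub, map_smul, map_sum, _root_.sub_apply, _root_.smul_apply,
        _root_.sum_apply, smul_eq_mul, SchwartzMap.fourierTransformCLM_apply] using e
    have h4 : ((1 + ‖ξ‖ ^ 2 : ℝ) : ℂ) = 1 + ∑ j, (ξ j : ℂ) ^ 2 := by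
      rw [EuclideanSpace.norm_sq_eq]
      push_cast
      simp only [Real.norm_eq_abs, ← Complex.ofReal_pow, sq_abs]
    rw [h3, h4]
    simp only [hD]
    have hpi : (Real.pi : ℂ) ≠ 0 := by exact_mod_cast Real.pi_ne_zero
    rw [add_mul, one_mul, sub_eq_add_neg, Finset.mul_sum, Finset.sum_mul,
      ← Finset.sum_neg_distrib]
    congr 1
    refine Finset.sum_congr rfl fun j _ => ?_
    field_simp
    rw [Complex.I_sq]
    ring
  induction N generalizing g with
  | zero => simp
  | succ N ih =>
    rw [pow_succ, clm_mul_apply, ih, h1]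
    push_cast
    ring

theorem integrable_weight_sq :
    Integrable (fun ξ : Conf n => ((1 + ‖ξ‖ ^ 2) ^ (n + 1))⁻¹ ^ 2) := by
  have h := integrable_rpow_neg_one_add_norm_sq (E := Conf n) (μ := volume) (r := 4 * (n + 1))
    (by rw [finrank_euclideanSpace_fin]; linarith)
  refine h.congr (Filter.Eventually.of_forall fun ξ => ?_)
  have hp : (0 : ℝ) ≤ 1 + ‖ξ‖ ^ 2 := by positivity
  have e : -(4 * ((n : ℝ) + 1)) / 2 = -(((n + 1) * 2 : ℕ) : ℝ) := by push_cast; ring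
  change (1 + ‖ξ‖ ^ 2) ^ (-(4 * ((n : ℝ) + 1)) / 2) = _
  rw [e, Real.rpow_neg hp, Real.rpow_natCast, pow_mul, ← inv_pow]

theorem norm_toL2_eq_fourier (g : 𝓢(Conf n, ℂ)) :
    ‖toL2 n g‖ = (∫ ξ, ‖𝓕 g ξ‖ ^ (2 : ℝ)) ^ (1 / (2 : ℝ)) := by
  have h : ‖toL2 n g‖ = ‖(𝓕 g).toLp 2 volume‖ := (SchwartzMap.norm_fourier_toL2_eq g).symm
  rw [h, SchwartzMap.norm_toLp' (by norm_num) (by norm_num)]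
  simp

theorem norm_apply_le_integral_fourier (g : 𝓢(Conf n, ℂ)) (x : Conf n) :
    ‖g x‖ ≤ ∫ ξ, ‖𝓕 g ξ‖ := by
  have h1 : g x = 𝓕 (𝓕 g) (-x) := by
    have e : 𝓕⁻ (𝓕 g) = g := by simp
    conv_lhs => rw [← e, SchwartzMap.fourierInv_apply_eq]
    rfl
  rw [h1, ← SchwartzMap.norm_toLp_one]
  exact SchwartzMap.norm_fourier_apply_le_toLp_one (𝓕 g) (-x)

/-- A Sobolev inequality: the supremum norm of `g` is bounded by the `L²` norm of
`(1 - Δ / 4π²) ^ (n + 1) g`. -/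
theorem exists_norm_apply_le : ∃ C : ℝ, 0 ≤ C ∧ ∀ (g : 𝓢(Conf n, ℂ)) (x : Conf n),
    ‖g x‖ ≤ C * ‖toL2 n ((besselOp n ^ (n + 1)) g)‖ := by
  set w : Conf n → ℝ := fun ξ => ((1 + ‖ξ‖ ^ 2) ^ (n + 1))⁻¹ with hw_def
  have hw0 : ∀ ξ, 0 ≤ w ξ := fun ξ => by positivity
  have hwc : Continuous w :=
    Continuous.inv₀ (by fun_prop) fun ξ => by positivity
  have hw : MemLp w 2 := (memLp_two_iff_integrable_sq hwc.aestronglyMeasurable).2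
    integrable_weight_sq
  refine ⟨(∫ ξ, w ξ ^ (2 : ℝ)) ^ (1 / (2 : ℝ)),
    Real.rpow_nonneg (integral_nonneg fun ξ => Real.rpow_nonneg (hw0 ξ) _) _, fun g x => ?_⟩
  have h2 : ∀ ξ, ‖𝓕 g ξ‖ = w ξ * ‖𝓕 ((besselOp n ^ (n + 1)) g) ξ‖ := by
    intro ξ
    rw [fourier_besselOp_pow_apply, norm_mul, Complex.norm_real,
      Real.norm_of_nonneg (by positivity), ← mul_assoc, hw_def]
    simp only
    rw [inv_mul_cancel₀ (by positivity), one_mul]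
  generalize (besselOp n ^ (n + 1)) g = G at h2
  have h3 : MemLp (fun ξ => ‖𝓕 G ξ‖) 2 := ((𝓕 G).memLp 2 volume).norm
  have h4 := integral_mul_le_Lp_mul_Lq_of_nonneg (μ := volume) Real.HolderConjugate.two_two
    (f := w) (g := fun ξ => ‖𝓕 G ξ‖)
    (Filter.Eventually.of_forall hw0)
    (Filter.Eventually.of_forall fun ξ => norm_nonneg _)
    (by simpa using hw) (by simpa using h3)
  rw [norm_toL2_eq_fourier]
  refine (norm_apply_le_integral_fourier g x).trans ?_
  rw [integral_congr_ae (Filter.Eventually.of_forall h2)]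
  exact h4

theorem tame_seminorm_zero_zero :
    Tame (SchwartzMap.seminorm ℂ 0 0 : Seminorm ℂ 𝓢(Conf n, ℂ)) := by
  obtain ⟨C, hC, h⟩ := exists_norm_apply_le (n := n)
  refine (tame_l2Seminorm.comp_besselOp_pow (n + 1)).mono C hC fun g => ?_
  refine SchwartzMap.seminorm_le_bound ℂ 0 0 g (mul_nonneg hC (apply_nonneg _ _)) fun x => ?_
  rw [pow_zero, one_mul, norm_iteratedFDeriv_zero]
  exact h g x

theorem norm_le_sum_abs (x : Conf n) : ‖x‖ ≤ ∑ j, |x j| := by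
  conv_lhs => rw [sum_coord_smul_single x]
  refine (norm_sum_le _ _).trans (le_of_eq (Finset.sum_congr rfl fun j _ => ?_))
  rw [norm_smul]
  simp

theorem tame_seminorm_zero (k : ℕ) :
    Tame (SchwartzMap.seminorm ℂ k 0 : Seminorm ℂ 𝓢(Conf n, ℂ)) := by
  induction k with
  | zero => exact tame_seminorm_zero_zero
  | succ k ih =>
    refine (tame_sum Finset.univ (fun j : Fin n => (SchwartzMap.seminorm ℂ k 0).comp
      (posOp j).toLinearMap) fun j _ => ih.comp_posOp j).mono 1 zero_le_one fun g => ?_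
    refine SchwartzMap.seminorm_le_bound ℂ (k + 1) 0 g
      (mul_nonneg zero_le_one (apply_nonneg _ _)) fun x => ?_
    rw [one_mul, _root_.sum_apply, norm_iteratedFDeriv_zero, pow_succ]
    calc ‖x‖ ^ k * ‖x‖ * ‖g x‖ ≤ ‖x‖ ^ k * (∑ j, |x j|) * ‖g x‖ := by
          gcongr
          exact norm_le_sum_abs x
      _ = ∑ j, ‖x‖ ^ k * ‖posOp j g x‖ := by
          rw [Finset.mul_sum, Finset.sum_mul]
          refine Finset.sum_congr rfl fun j _ => ?_
          rw [posOp_apply, norm_mul, Complex.norm_real, Real.norm_eq_abs, mul_assoc]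
      _ ≤ _ := Finset.sum_le_sum fun j _ =>
          SchwartzMap.norm_pow_mul_le_seminorm ℂ (posOp j g) k x

/-- The map `c ↦ (y ↦ y_j c)`. -/
def coordSMulRight (j : Fin n) : ℂ →L[ℝ] (Conf n →L[ℝ] ℂ) :=
  ContinuousLinearMap.smulRightL ℝ (Conf n) ℂ (EuclideanSpace.proj (𝕜 := ℝ) j)

theorem fderiv_eq_sum (g : 𝓢(Conf n, ℂ)) :
    fderiv ℝ g = ∑ j, coordSMulRight j ∘ derivOp j g := by
  ext x y
  rw [Finset.sum_apply, _root_.sum_apply]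
  conv_lhs => rw [sum_coord_smul_single y]
  rw [map_sum]
  refine Finset.sum_congr rfl fun j _ => ?_
  rw [map_smul]
  rfl

/-- Every Schwartz seminorm reduces to the supremum norm after applying coordinate multiplications
and partial derivatives. -/
theorem tame_seminorm (k m : ℕ) :
    Tame (SchwartzMap.seminorm ℂ k m : Seminorm ℂ 𝓢(Conf n, ℂ)) := by
  induction m with
  | zero => exact tame_seminorm_zero k
  | succ m ih =>
    set L : ℝ := ∑ j : Fin n, ‖coordSMulRight j‖ with hL
    refine (tame_sum Finset.univ (fun j : Fin n => (SchwartzMap.seminorm ℂ k m).comp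
      (derivOp j).toLinearMap) fun j _ => ih.comp_derivOp j).mono L (by positivity) fun g => ?_
    refine SchwartzMap.seminorm_le_bound ℂ k (m + 1) g
      (mul_nonneg (by positivity) (apply_nonneg _ _)) fun x => ?_
    rw [_root_.sum_apply, ← norm_iteratedFDeriv_fderiv, fderiv_eq_sum,
      iteratedFDeriv_sum_apply fun j _ => ((coordSMulRight j).contDiff.comp
        ((derivOp j g).smooth m)).contDiffAt]
    calc ‖x‖ ^ k * ‖∑ j, iteratedFDeriv ℝ m (coordSMulRight j ∘ derivOp j g) x‖
        ≤ ‖x‖ ^ k * ∑ j, ‖coordSMulRight j‖ * ‖iteratedFDeriv ℝ m (derivOp j g) x‖ := by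
          gcongr
          refine (norm_sum_le _ _).trans (Finset.sum_le_sum fun j _ => ?_)
          exact (coordSMulRight j).norm_iteratedFDeriv_comp_left
            ((derivOp j g).smooth m).contDiffAt le_rfl
      _ = ∑ j, ‖coordSMulRight j‖ * (‖x‖ ^ k * ‖iteratedFDeriv ℝ m (derivOp j g) x‖) := by
          rw [Finset.mul_sum]
          exact Finset.sum_congr rfl fun j _ => by ring
      _ ≤ ∑ j, L * SchwartzMap.seminorm ℂ k m (derivOp j g) := by
          refine Finset.sum_le_sum fun j _ => mul_le_mul ?_
            (SchwartzMap.le_seminorm ℂ k m (derivOp j g) x) (by positivity) (by positivity)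
          exact Finset.single_le_sum (f := fun j : Fin n => ‖coordSMulRight j‖)
            (fun i _ => by positivity) (Finset.mem_univ j)
      _ = _ := by
          rw [← Finset.mul_sum]
          rfl

/-! ### The Gaussian and the Hermite spaces -/

theorem pow_mul_exp_neg_sq_le (K : ℕ) (r : ℝ) (hr : 0 ≤ r) :
    (1 + r) ^ K * Real.exp (-r ^ 2 / 2) ≤ Real.exp (3 / 2) * K.factorial := by
  have h1 : Real.exp (-r ^ 2 / 2) ≤ Real.exp (3 / 2) * Real.exp (-(1 + r)) := by
    rw [← Real.exp_add]
    exact Real.exp_le_exp.2 (by nlinarith [sq_nonneg (r - 1)])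
  have h2 := Real.pow_div_factorial_le_exp (1 + r) (by linarith) K
  have h3 : (0 : ℝ) < K.factorial := by exact_mod_cast K.factorial_pos
  rw [div_le_iff₀ h3] at h2
  calc (1 + r) ^ K * Real.exp (-r ^ 2 / 2)
      ≤ (Real.exp (1 + r) * K.factorial) * (Real.exp (3 / 2) * Real.exp (-(1 + r))) :=
        mul_le_mul h2 h1 (Real.exp_nonneg _) (by positivity)
    _ = Real.exp (3 / 2) * K.factorial * (Real.exp (1 + r) * Real.exp (-(1 + r))) := by ring
    _ = _ := by rw [← Real.exp_add, add_neg_cancel, Real.exp_zero, mul_one]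

theorem contDiff_neg_norm_sq_div :
    ContDiff ℝ ∞ (fun x : Conf n => -‖x‖ ^ 2 / 2) :=
  (contDiff_norm_sq ℝ).neg.div_const 2

/-- The real Gaussian `exp (-‖x‖² / 2)` as a Schwartz function. -/
def realGaussian (n : ℕ) : 𝓢(Conf n, ℝ) where
  toFun x := Real.exp (-‖x‖ ^ 2 / 2)
  smooth' := Real.contDiff_exp.comp contDiff_neg_norm_sq_div
  decay' k m := by
    have htg : (fun x : Conf n => -‖x‖ ^ 2 / 2).HasTemperateGrowth := by
      have h := (Function.HasTemperateGrowth.const (E := Conf n) (-(1 / 2) : ℝ)).mul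
        (Function.hasTemperateGrowth_norm_sq (H := Conf n))
      have e : (fun x : Conf n => -‖x‖ ^ 2 / 2) =
          (fun _ => (-(1 / 2) : ℝ)) * fun x : Conf n => ‖x‖ ^ 2 := by
        ext x
        rw [Pi.mul_apply]
        ring
      rwa [e]
    -- the chain rule estimate needs a bound `D ^ i` with `1 ≤ D`
    obtain ⟨a, C, hC, hb⟩ := htg.norm_iteratedFDeriv_le_uniform m
    refine ⟨m.factorial * (1 + C) ^ m * (Real.exp (3 / 2) * (k + a * m).factorial), fun x => ?_⟩
    set D := (1 + C) * (1 + ‖x‖) ^ a with hD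
    have h1x : (1 : ℝ) ≤ 1 + ‖x‖ := by linarith [norm_nonneg x]
    have hD1 : 1 ≤ D := one_le_mul_of_one_le_of_one_le (by linarith) (one_le_pow₀ h1x)
    have h1 := norm_iteratedFDeriv_comp_le (n := m) (N := ∞) Real.contDiff_exp
      (contDiff_neg_norm_sq_div (n := n)) (by exact_mod_cast le_top) x
      (C := Real.exp (-‖x‖ ^ 2 / 2)) (D := D)
      (fun i _ => by
        rw [norm_iteratedFDeriv_eq_norm_iteratedDeriv, iteratedDeriv_eq_iterate,
          Real.iter_deriv_exp, Real.norm_of_nonneg (Real.exp_nonneg _)])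
      (fun i hi1 him => by
        refine (hb i him x).trans (le_trans ?_ (le_self_pow₀ hD1 (by omega)))
        rw [hD]
        gcongr
        linarith)
    calc ‖x‖ ^ k * ‖iteratedFDeriv ℝ m (fun x : Conf n => Real.exp (-‖x‖ ^ 2 / 2)) x‖
        ≤ (1 + ‖x‖) ^ k * (m.factorial * Real.exp (-‖x‖ ^ 2 / 2) * D ^ m) := by
          gcongr
          · linarith
          · exact h1
      _ = m.factorial * (1 + C) ^ m * ((1 + ‖x‖) ^ (k + a * m) * Real.exp (-‖x‖ ^ 2 / 2)) := by
          rw [hD, mul_pow, ← pow_mul, pow_add]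
          ring
      _ ≤ _ := mul_le_mul_of_nonneg_left (pow_mul_exp_neg_sq_le _ _ (norm_nonneg x))
          (by positivity)

/-- The Gaussian `exp (-‖x‖² / 2)` as a complex Schwartz function. -/
def gaussian (n : ℕ) : 𝓢(Conf n, ℂ) :=
  SchwartzMap.postcompCLM (𝕜 := ℝ) Complex.ofRealCLM (realGaussian n)

theorem gaussian_apply (x : Conf n) : gaussian n x = (Real.exp (-‖x‖ ^ 2 / 2) : ℂ) := rfl

theorem derivOp_gaussian (j : Fin n) : derivOp j (gaussian n) = -posOp j (gaussian n) := by
  ext x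
  have h1 : HasFDerivAt (fun x : Conf n => -‖x‖ ^ 2 / 2) (-innerSL ℝ x) x := by
    have h := ((hasStrictFDerivAt_norm_sq x).hasFDerivAt.neg).mul_const (2⁻¹ : ℝ)
    refine (h.congr_fderiv ?_)
    ext y
    simp
  have h2 := Complex.ofRealCLM.hasFDerivAt.comp x h1.exp
  rw [derivOp_apply]
  change fderiv ℝ (Complex.ofRealCLM ∘ fun x : Conf n => Real.exp (-‖x‖ ^ 2 / 2)) x _ = _
  rw [h2.fderiv, _root_.neg_apply, posOp_apply, gaussian_apply]
  simp [EuclideanSpace.inner_single_right]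
  ring

theorem annihilationOp_gaussian (j : Fin n) : annihilationOp j (gaussian n) = 0 := by
  rw [annihilationOp, _root_.add_apply, derivOp_gaussian, add_neg_cancel]

theorem hermiteOp_gaussian : hermiteOp n (gaussian n) = (n : ℂ) • gaussian n := by
  have h : ∀ j : Fin n, posOp j (posOp j (gaussian n)) - derivOp j (derivOp j (gaussian n)) =
      gaussian n := by
    intro j
    have h1 := congrArg (fun B => B (gaussian n)) (derivOp_mul_posOp j j)
    simp only [if_true, clm_mul_apply, _root_.add_apply, derivOp_gaussian, map_neg] at h1
    rw [derivOp_gaussian, map_neg, h1]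
    simp
  rw [hermiteOp_apply, Finset.sum_congr rfl fun j _ => h j]
  simp [Nat.cast_smul_eq_nsmul]

/-- The span of the Hermite functions of degree `m`: the products of `m` creation operators,
applied to the Gaussian. -/
def hermiteSpace (n : ℕ) : ℕ → Submodule ℂ 𝓢(Conf n, ℂ)
  | 0 => Submodule.span ℂ {gaussian n}
  | m + 1 => ⨆ j : Fin n, (hermiteSpace n m).map (creationOp j).toLinearMap

instance finiteDimensional_hermiteSpace (m : ℕ) : FiniteDimensional ℂ (hermiteSpace n m) := by
  induction m with
  | zero => rw [hermiteSpace]; infer_instance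
  | succ m ih => rw [hermiteSpace]; infer_instance

theorem creationOp_mem_hermiteSpace {m : ℕ} {g : 𝓢(Conf n, ℂ)} (hg : g ∈ hermiteSpace n m)
    (j : Fin n) : creationOp j g ∈ hermiteSpace n (m + 1) :=
  Submodule.mem_iSup_of_mem j (Submodule.mem_map_of_mem hg)

theorem hermiteSpace_succ_le {m : ℕ} {W : Submodule ℂ 𝓢(Conf n, ℂ)}
    (h : ∀ j, ∀ g ∈ hermiteSpace n m, creationOp j g ∈ W) : hermiteSpace n (m + 1) ≤ W :=
  iSup_le fun j => Submodule.map_le_iff_le_comap.2 fun g hg => h j g hg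

theorem hermiteOp_of_mem (m : ℕ) {g : 𝓢(Conf n, ℂ)} (hg : g ∈ hermiteSpace n m) :
    hermiteOp n g = ((2 * m + n : ℝ) : ℂ) • g := by
  induction m generalizing g with
  | zero =>
    obtain ⟨c, rfl⟩ := Submodule.mem_span_singleton.1 hg
    rw [map_smul, hermiteOp_gaussian, smul_comm]
    simp
  | succ m ih =>
    let W : Submodule ℂ 𝓢(Conf n, ℂ) := LinearMap.ker
      ((hermiteOp n - ((2 * (m + 1 : ℕ) + n : ℝ) : ℂ) • 1).toLinearMap)
    have hW : ∀ g, g ∈ W ↔ hermiteOp n g = ((2 * (m + 1 : ℕ) + n : ℝ) : ℂ) • g := fun g => sub_eq_zero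
    refine (hW g).1 (hermiteSpace_succ_le (fun j g hg => (hW _).2 ?_) hg)
    rw [hermiteOp_creationOp, ih hg, map_smul]
    push_cast
    module

theorem annihilationOp_mem_hermiteSpace {m : ℕ} {g : 𝓢(Conf n, ℂ)}
    (hg : g ∈ hermiteSpace n (m + 1)) (i : Fin n) : annihilationOp i g ∈ hermiteSpace n m := by
  induction m generalizing g with
  | zero =>
    have h : hermiteSpace n 1 ≤ (hermiteSpace n 0).comap (annihilationOp i).toLinearMap := by
      refine hermiteSpace_succ_le fun j g hg => ?_
      obtain ⟨c, rfl⟩ := Submodule.mem_span_singleton.1 hg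
      change annihilationOp i (creationOp j (c • gaussian n)) ∈ hermiteSpace n 0
      rw [annihilationOp_creationOp, map_smul, annihilationOp_gaussian, smul_zero, map_zero,
        zero_add]
      split_ifs
      · exact Submodule.smul_mem _ _ hg
      · exact Submodule.zero_mem _
    exact h hg
  | succ m ih =>
    have h : hermiteSpace n (m + 1 + 1) ≤
        (hermiteSpace n (m + 1)).comap (annihilationOp i).toLinearMap := by
      refine hermiteSpace_succ_le fun j g hg => ?_
      change annihilationOp i (creationOp j g) ∈ hermiteSpace n (m + 1)
      rw [annihilationOp_creationOp]
      refine Submodule.add_mem _ (creationOp_mem_hermiteSpace (ih hg) j) ?_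
      split_ifs
      · exact Submodule.smul_mem _ _ hg
      · exact Submodule.zero_mem _
    exact h hg

theorem posOp_mem_iSup_hermiteSpace {g : 𝓢(Conf n, ℂ)} (hg : g ∈ ⨆ m, hermiteSpace n m)
    (j : Fin n) : posOp j g ∈ ⨆ m, hermiteSpace n m := by
  have h : ⨆ m, hermiteSpace n m ≤ (⨆ m, hermiteSpace n m).comap (posOp j).toLinearMap := by
    refine iSup_le fun m g hg => ?_
    change posOp j g ∈ ⨆ m, hermiteSpace n m
    rw [posOp_eq]
    refine Submodule.smul_mem _ _ (Submodule.add_mem _ ?_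
      (Submodule.mem_iSup_of_mem (m + 1) (creationOp_mem_hermiteSpace hg j)))
    cases m with
    | zero =>
      obtain ⟨c, rfl⟩ := Submodule.mem_span_singleton.1 hg
      rw [map_smul, annihilationOp_gaussian, smul_zero]
      exact Submodule.zero_mem _
    | succ m => exact Submodule.mem_iSup_of_mem m (annihilationOp_mem_hermiteSpace hg j)
  exact h hg

theorem exists_inner_pow_mul_gaussian (ξ : Conf n) (k : ℕ) :
    ∃ g ∈ ⨆ m, hermiteSpace n m, ∀ x, g x = ((inner ℝ x ξ : ℝ) : ℂ) ^ k * gaussian n x := by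
  induction k with
  | zero =>
    exact ⟨gaussian n, Submodule.mem_iSup_of_mem 0 (Submodule.mem_span_singleton_self _),
      fun x => by simp⟩
  | succ k ih =>
    obtain ⟨g, hg, hgx⟩ := ih
    refine ⟨∑ j, (ξ j : ℂ) • posOp j g, Submodule.sum_mem _ fun j _ =>
      Submodule.smul_mem _ _ (posOp_mem_iSup_hermiteSpace hg j), fun x => ?_⟩
    have h : inner ℝ x ξ = ∑ j, ξ j * x j := by simp [PiLp.inner_apply]
    simp only [_root_.sum_apply, _root_.smul_apply, posOp_apply, hgx, smul_eq_mul]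
    rw [pow_succ, h]
    push_cast
    rw [Finset.mul_sum, Finset.sum_mul]
    exact Finset.sum_congr rfl fun j _ => by ring

/-- Complex conjugation on Schwartz functions. -/
def conjOp (n : ℕ) : 𝓢(Conf n, ℂ) →L[ℝ] 𝓢(Conf n, ℂ) :=
  SchwartzMap.postcompCLM (𝕜 := ℝ) (Complex.conjCLE : ℂ →L[ℝ] ℂ)

theorem conjOp_apply (g : 𝓢(Conf n, ℂ)) (x : Conf n) :
    conjOp n g x = (starRingEnd ℂ) (g x) := rfl

/-- The Hermite functions are complete.  If `v` is orthogonal to all of them, then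
`∫ conj (v x) ⟨x, ξ⟩ ^ k exp (-‖x‖² / 2) = 0` for all `ξ` and `k`; summing over `k` shows that the
Fourier transform of `conj v · exp (-‖x‖² / 2)` vanishes. -/
theorem eq_zero_of_inner_eq_zero {v : 𝓢(Conf n, ℂ)}
    (hv : ∀ m, ∀ g ∈ hermiteSpace n m, inner ℂ (toL2 n v) (toL2 n g) = 0) : v = 0 := by
  have hD : ∀ g ∈ ⨆ m, hermiteSpace n m, inner ℂ (toL2 n v) (toL2 n g) = 0 := by
    let W : Submodule ℂ 𝓢(Conf n, ℂ) :=
      LinearMap.ker ((innerSL ℂ (toL2 n v)).toLinearMap.comp (toL2 n).toLinearMap)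
    have h : ⨆ m, hermiteSpace n m ≤ W := iSup_le fun m g hg => hv m g hg
    exact fun g hg => h hg
  have hte : (gaussian n : Conf n → ℂ).HasTemperateGrowth := (gaussian n).hasTemperateGrowth
  set F : 𝓢(Conf n, ℂ) := SchwartzMap.smulLeftCLM ℂ (gaussian n) (conjOp n v) with hF
  have hFx : ∀ x, F x = gaussian n x * (starRingEnd ℂ) (v x) := fun x => by
    rw [hF, SchwartzMap.smulLeftCLM_apply_apply hte]
    rfl
  have hFour : 𝓕 F = 0 := by
    ext ξ
    -- the coefficients of the power series vanish by orthogonality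
    have hterm : ∀ k : ℕ, ∫ x, (((-2 * Real.pi * inner ℝ x ξ : ℝ) : ℂ) * Complex.I) ^ k /
        k.factorial * F x = 0 := by
      intro k
      obtain ⟨g, hg, hgx⟩ := exists_inner_pow_mul_gaussian ξ k
      have h := hD g hg
      rw [inner_toL2] at h
      have e : ∀ x, (((-2 * Real.pi * inner ℝ x ξ : ℝ) : ℂ) * Complex.I) ^ k /
          k.factorial * F x = ((-2 * Real.pi * Complex.I) ^ k / k.factorial) *
            inner ℂ (v x) (g x) := by
        intro x
        rw [hFx, RCLike.inner_apply', hgx]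
        push_cast
        ring
      simp_rw [e]
      rw [integral_const_mul, h, mul_zero]
    set c : ℝ := 2 * Real.pi * ‖ξ‖ with hc
    have hc0 : 0 ≤ c := by positivity
    have hsum : ∀ x : Conf n, HasSum (fun k : ℕ => (c * ‖x‖) ^ k / k.factorial * ‖F x‖)
        (Real.exp (c * ‖x‖) * ‖F x‖) := by
      intro x
      have h := NormedSpace.expSeries_div_hasSum_exp (c * ‖x‖)
      rw [← Real.exp_eq_exp_ℝ] at h
      exact h.mul_right _
    have hF_le : ∀ x, Real.exp (c * ‖x‖) * ‖F x‖ ≤ Real.exp (c ^ 2 / 2) * ‖v x‖ := by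
      intro x
      rw [hFx, norm_mul, RCLike.norm_conj, gaussian_apply, Complex.norm_real,
        Real.norm_of_nonneg (Real.exp_nonneg _), ← mul_assoc, ← Real.exp_add]
      refine mul_le_mul_of_nonneg_right (Real.exp_le_exp.2 ?_) (norm_nonneg _)
      nlinarith [sq_nonneg (c - ‖x‖)]
    have h := hasSum_integral_of_dominated_convergence (μ := (volume : Measure (Conf n)))
      (F := fun (k : ℕ) x => (((-2 * Real.pi * inner ℝ x ξ : ℝ) : ℂ) * Complex.I) ^ k /
        k.factorial * F x)
      (f := fun x => Complex.exp (((-2 * Real.pi * inner ℝ x ξ : ℝ) : ℂ) * Complex.I) * F x)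
      (fun k x => (c * ‖x‖) ^ k / k.factorial * ‖F x‖)
      (fun k => by
        have := F.continuous
        exact Continuous.aestronglyMeasurable (by fun_prop))
      (fun k => Filter.Eventually.of_forall fun x => by
        rw [norm_mul, norm_div, norm_pow, norm_mul, Complex.norm_I, mul_one, Complex.norm_real,
          Complex.norm_natCast]
        have h1 : ‖-2 * Real.pi * inner ℝ x ξ‖ ≤ c * ‖x‖ := by
          rw [norm_mul, norm_mul, norm_neg, Real.norm_of_nonneg Real.pi_pos.le, Real.norm_two]
          have h2 := norm_inner_le_norm (𝕜 := ℝ) x ξ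
          calc 2 * Real.pi * ‖(inner ℝ x ξ : ℝ)‖ ≤ 2 * Real.pi * (‖x‖ * ‖ξ‖) := by gcongr
            _ = c * ‖x‖ := by rw [hc]; ring
        gcongr)
      (Filter.Eventually.of_forall fun x => (hsum x).summable)
      (by
        simp_rw [fun x => (hsum x).tsum_eq]
        refine ((v.integrable (μ := volume)).norm.const_mul (Real.exp (c ^ 2 / 2))).mono' ?_
          (Filter.Eventually.of_forall fun x => ?_)
        · have := F.continuous
          exact Continuous.aestronglyMeasurable (by fun_prop)
        · rw [Real.norm_of_nonneg (by positivity)]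
          exact hF_le x)
      (Filter.Eventually.of_forall fun x => by
        have h := NormedSpace.expSeries_div_hasSum_exp
          (((-2 * Real.pi * inner ℝ x ξ : ℝ) : ℂ) * Complex.I)
        rw [← Complex.exp_eq_exp_ℂ] at h
        exact h.mul_right _)
    simp_rw [hterm] at h
    rw [SchwartzMap.fourier_coe, Real.fourier_eq']
    exact h.unique hasSum_zero
  have hF0 : F = 0 := by
    have h : 𝓕⁻ (𝓕 F) = F := by simp
    rw [← h, hFour]
    exact map_zero (FourierTransform.fourierCLE ℂ 𝓢(Conf n, ℂ)).symm
  ext x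
  have h := hFx x
  rw [hF0, _root_.zero_apply, gaussian_apply, eq_comm, mul_eq_zero] at h
  rcases h with h | h
  · exact absurd h (by exact_mod_cast (Real.exp_pos _).ne')
  · simpa using h

/-! ### Series of Schwartz functions -/

theorem norm_tsum_sub_sum_le {V : Type*} [NormedAddCommGroup V] [CompleteSpace V] {a : ℕ → V}
    {b : ℕ → ℝ} (hb : Summable b) (hab : ∀ i, ‖a i‖ ≤ b i) (s : Finset ℕ) :
    ‖∑ i ∈ s, a i - ∑' i, a i‖ ≤ ∑' i, b i - ∑ i ∈ s, b i := by
  have ha : Summable a := .of_norm_bounded hb hab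
  rw [← ha.sum_add_tsum_subtype_compl s, ← hb.sum_add_tsum_subtype_compl s, sub_add_cancel_left,
    norm_neg, add_sub_cancel_left]
  exact tsum_of_norm_bounded (hb.subtype _).hasSum fun i => hab i

/-- A series of Schwartz functions whose seminorms are summable converges in Schwartz space. -/
theorem exists_hasSum_of_summable_seminorm (F : ℕ → 𝓢(Conf n, ℂ))
    (hF : ∀ k m, Summable fun i => SchwartzMap.seminorm ℂ k m (F i)) : ∃ w, HasSum F w := by
  have hbound : ∀ (m : ℕ) (i : ℕ) (x : Conf n), (m : ℕ∞) ≤ (⊤ : ℕ∞) →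
      ‖iteratedFDeriv ℝ m (F i) x‖ ≤ SchwartzMap.seminorm ℂ 0 m (F i) :=
    fun m i x _ => SchwartzMap.norm_iteratedFDeriv_le_seminorm ℂ (F i) m x
  have hder : ∀ (m : ℕ) (x : Conf n), iteratedFDeriv ℝ m (fun y => ∑' i, F i y) x =
      ∑' i, iteratedFDeriv ℝ m (F i) x := fun m x =>
    iteratedFDeriv_tsum_apply (N := ⊤) (fun i => (F i).smooth ⊤) (fun m _ => hF 0 m) hbound le_top x
  have hterm : ∀ (k m : ℕ) (x : Conf n) (i : ℕ),
      ‖(‖x‖ ^ k) • iteratedFDeriv ℝ m (F i) x‖ ≤ SchwartzMap.seminorm ℂ k m (F i) := by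
    intro k m x i
    rw [norm_smul, norm_pow, norm_norm]
    exact SchwartzMap.le_seminorm ℂ k m (F i) x
  let w : 𝓢(Conf n, ℂ) :=
    { toFun := fun x => ∑' i, F i x
      smooth' := contDiff_tsum (N := ⊤) (fun i => (F i).smooth ⊤) (fun m _ => hF 0 m) hbound
      decay' := fun k m => ⟨∑' i, SchwartzMap.seminorm ℂ k m (F i), fun x => by
        rw [hder, ← norm_norm x, ← norm_pow, ← norm_smul, ← tsum_const_smul'']
        exact tsum_of_norm_bounded (hF k m).hasSum (hterm k m x)⟩ }
  refine ⟨w, ((schwartz_withSeminorms ℂ (Conf n) ℂ).tendsto_nhds _ _).2 fun km ε hε => ?_⟩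
  obtain ⟨k, m⟩ := km
  have hlim : Filter.Tendsto (fun s : Finset ℕ => ∑' i, SchwartzMap.seminorm ℂ k m (F i) -
      ∑ i ∈ s, SchwartzMap.seminorm ℂ k m (F i)) Filter.atTop (nhds 0) := by
    have h := (hF k m).hasSum.const_sub (∑' i, SchwartzMap.seminorm ℂ k m (F i))
    rwa [sub_self] at h
  filter_upwards [hlim.eventually_lt_const hε] with s hs
  refine lt_of_le_of_lt (SchwartzMap.seminorm_le_bound ℂ k m _ ?_ fun x => ?_) hs
  · rw [sub_nonneg]
    exact (hF k m).sum_le_tsum s fun i _ => apply_nonneg _ _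
  · have h1 : iteratedFDeriv ℝ m (∑ i ∈ s, F i - w : 𝓢(Conf n, ℂ)) x =
        ∑ i ∈ s, iteratedFDeriv ℝ m (F i) x - ∑' i, iteratedFDeriv ℝ m (F i) x := by
      have e : (⇑(∑ i ∈ s, F i - w : 𝓢(Conf n, ℂ))) =
          (∑ i ∈ s, ⇑(F i)) - fun y => ∑' i, F i y := by
        ext y
        simp only [_root_.sub_apply, _root_.sum_apply, Pi.sub_apply, Finset.sum_apply]
        rfl
      rw [e, iteratedFDeriv_sub_apply, hder,
        iteratedFDeriv_sum_apply fun i _ => ((F i).smooth m).contDiffAt]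
      · rw [Finset.sum_fn]
        exact ContDiffAt.sum fun i _ => ((F i).smooth m).contDiffAt
      · exact (w.smooth m).contDiffAt
    rw [h1, ← norm_norm x, ← norm_pow, ← norm_smul, smul_sub, Finset.smul_sum,
      ← tsum_const_smul'']
    exact norm_tsum_sub_sum_le (hF k m) (hterm k m x) s

/-! ### Hermite expansions -/

theorem inner_eq_zero_of_mem_hermiteSpace {m l : ℕ} (hml : m ≠ l) {g h : 𝓢(Conf n, ℂ)}
    (hg : g ∈ hermiteSpace n m) (hh : h ∈ hermiteSpace n l) :
    inner ℂ (toL2 n g) (toL2 n h) = 0 := by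
  have e := inner_hermiteOp g h
  rw [hermiteOp_of_mem m hg, hermiteOp_of_mem l hh, map_smul, map_smul, inner_smul_left,
    inner_smul_right, Complex.conj_ofReal, ← sub_eq_zero, ← sub_mul, mul_eq_zero,
    ← Complex.ofReal_sub, Complex.ofReal_eq_zero] at e
  refine e.resolve_left fun e => hml ?_
  have : (m : ℝ) = l := by linarith
  exact_mod_cast this

/-- Riesz representation on a finite-dimensional subspace, for the inner product pulled back along
an injective linear map. -/
theorem exists_inner_eq {V E : Type*} [AddCommGroup V] [Module ℂ V] [NormedAddCommGroup E]
    [InnerProductSpace ℂ E] (T : V →ₗ[ℂ] E) (hT : Function.Injective T) (W : Submodule ℂ V)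
    [FiniteDimensional ℂ W] (φ : V →ₗ[ℂ] ℂ) : ∃ z ∈ W, ∀ v ∈ W, φ v = inner ℂ (T z) (T v) := by
  let e : W ≃ₗ[ℂ] W.map T := Submodule.equivMapOfInjective T hT W
  have he : ∀ y : W, (e y : E) = T y := fun y => rfl
  let ψ : W.map T →L[ℂ] ℂ := LinearMap.toContinuousLinearMap
    ((φ.comp W.subtype).comp e.symm.toLinearMap)
  have : CompleteSpace (W.map T) := FiniteDimensional.complete ℂ (W.map T)
  refine ⟨e.symm ((InnerProductSpace.toDual ℂ (W.map T)).symm ψ), Subtype.property _,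
    fun v hv => ?_⟩
  have h1 := InnerProductSpace.toDual_symm_apply (𝕜 := ℂ) (x := e ⟨v, hv⟩) (y := ψ)
  have h2 : ψ (e ⟨v, hv⟩) = φ v := by
    change φ (e.symm (e ⟨v, hv⟩)) = _
    rw [e.symm_apply_apply]
  rw [← h2, ← h1, Submodule.coe_inner, he, ← he (e.symm _), e.apply_symm_apply]

theorem exists_hermiteProj (m : ℕ) (u : 𝓢(Conf n, ℂ)) : ∃ z ∈ hermiteSpace n m,
    ∀ g ∈ hermiteSpace n m, inner ℂ (toL2 n u) (toL2 n g) = inner ℂ (toL2 n z) (toL2 n g) :=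
  exists_inner_eq (toL2 n).toLinearMap toL2_injective (hermiteSpace n m)
    ((innerSL ℂ (toL2 n u)).toLinearMap.comp (toL2 n).toLinearMap)

/-- The `L²`-orthogonal projection onto the Hermite functions of degree `m`. -/
def hermiteProj (m : ℕ) (u : 𝓢(Conf n, ℂ)) : 𝓢(Conf n, ℂ) := (exists_hermiteProj m u).choose

theorem hermiteProj_mem (m : ℕ) (u : 𝓢(Conf n, ℂ)) : hermiteProj m u ∈ hermiteSpace n m :=
  (exists_hermiteProj m u).choose_spec.1

theorem inner_hermiteProj {m : ℕ} (u : 𝓢(Conf n, ℂ)) {g : 𝓢(Conf n, ℂ)}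
    (hg : g ∈ hermiteSpace n m) :
    inner ℂ (toL2 n (hermiteProj m u)) (toL2 n g) = inner ℂ (toL2 n u) (toL2 n g) :=
  ((exists_hermiteProj m u).choose_spec.2 g hg).symm

/-- The eigenvalue of `1 + ‖x‖² - Δ` on the Hermite functions of degree `m`. -/
def level (n m : ℕ) : ℝ := 1 + (2 * m + n)

theorem one_add_abs_eq_level (m : ℕ) : 1 + |(2 * m + n : ℝ)| = level n m := by
  rw [abs_of_nonneg (by positivity), level]

theorem level_pos (m : ℕ) : 0 < level n m := by
  unfold level
  positivity

theorem inner_pow_hermiteOp (N : ℕ) {m : ℕ} (u : 𝓢(Conf n, ℂ)) {g : 𝓢(Conf n, ℂ)}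
    (hg : g ∈ hermiteSpace n m) :
    inner ℂ (toL2 n (((1 + hermiteOp n) ^ N) u)) (toL2 n g) =
      (level n m ^ N : ℝ) * inner ℂ (toL2 n u) (toL2 n g) := by
  induction N generalizing u with
  | zero => simp
  | succ N ih =>
    have h : inner ℂ (toL2 n ((1 + hermiteOp n) u)) (toL2 n g) =
        (level n m : ℂ) * inner ℂ (toL2 n u) (toL2 n g) := by
      rw [_root_.add_apply, map_add, inner_add_left, inner_hermiteOp, hermiteOp_of_mem m hg,
        map_smul, inner_smul_right, level]
      change inner ℂ (toL2 n u) (toL2 n g) + _ = _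
      push_cast
      ring
    rw [pow_succ, clm_mul_apply, ih, h]
    push_cast
    ring

/-- A sequence of Hermite functions of increasing degrees whose `L²` norms decay faster than any
power of the degree. -/
def RapidlyDecreasing (z : ℕ → 𝓢(Conf n, ℂ)) : Prop :=
  (∀ m, z m ∈ hermiteSpace n m) ∧ ∀ N : ℕ, ∃ C, ∀ m, level n m ^ N * ‖toL2 n (z m)‖ ≤ C

/-- Since `1 + H` is symmetric and acts on the degree `m` part as `level n m`, powers of the level are
absorbed into `(1 + H) ^ N u`. -/
theorem rapidlyDecreasing_hermiteProj (u : 𝓢(Conf n, ℂ)) :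
    RapidlyDecreasing fun m => hermiteProj m u := by
  refine ⟨fun m => hermiteProj_mem m u, fun N => ⟨‖toL2 n (((1 + hermiteOp n) ^ N) u)‖,
    fun m => ?_⟩⟩
  have hP := hermiteProj_mem m u
  have h1 := inner_pow_hermiteOp N u hP
  rw [← inner_hermiteProj u hP, inner_self_eq_norm_sq_to_K] at h1
  have h2 := norm_inner_le_norm (𝕜 := ℂ) (toL2 n (((1 + hermiteOp n) ^ N) u))
    (toL2 n (hermiteProj m u))
  rw [h1, norm_mul, norm_pow, Complex.norm_real, RCLike.norm_ofReal, abs_norm,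
    Real.norm_of_nonneg (pow_nonneg (level_pos m).le N), sq, ← mul_assoc] at h2
  rcases (norm_nonneg (toL2 n (hermiteProj m u))).eq_or_lt with h0 | h0
  · rw [← h0, mul_zero]
    exact norm_nonneg _
  · exact le_of_mul_le_mul_right h2 h0

theorem Tame.exists_le_level {p : Seminorm ℂ 𝓢(Conf n, ℂ)} (hp : Tame p) :
    ∃ (C : ℝ) (M : ℕ), 0 ≤ C ∧ ∀ (m : ℕ), ∀ g ∈ hermiteSpace n m,
      p g ≤ C * level n m ^ M * ‖toL2 n g‖ := by
  obtain ⟨C, M, hC, h⟩ := hp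
  refine ⟨C, M, hC, fun m g hg => ?_⟩
  rw [← one_add_abs_eq_level]
  exact h _ g (hermiteOp_of_mem m hg)

theorem RapidlyDecreasing.exists_hasSum {z : ℕ → 𝓢(Conf n, ℂ)} (hz : RapidlyDecreasing z) :
    ∃ w, HasSum z w := by
  refine exists_hasSum_of_summable_seminorm z fun k j => ?_
  obtain ⟨C, M, hC, h⟩ := (tame_seminorm (n := n) k j).exists_le_level
  obtain ⟨C', hC'⟩ := hz.2 (M + 2)
  have hs : Summable fun m : ℕ => C * C' * (1 / ((m : ℝ) + 1) ^ 2) := by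
    have h2 := (summable_nat_add_iff 1).2 (Real.summable_one_div_nat_pow.2 one_lt_two)
    refine Summable.mul_left _ ?_
    exact_mod_cast h2
  refine Summable.of_nonneg_of_le (fun m => apply_nonneg _ _) (fun m => ?_) hs
  have hl := level_pos (n := n) m
  have h1 : ((m : ℝ) + 1) ^ 2 ≤ level n m ^ 2 := by
    refine pow_le_pow_left₀ (by positivity) ?_ 2
    unfold level
    linarith [(Nat.cast_nonneg m : (0 : ℝ) ≤ m), (Nat.cast_nonneg n : (0 : ℝ) ≤ n)]
  rw [mul_one_div, le_div_iff₀ (by positivity)]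
  calc SchwartzMap.seminorm ℂ k j (z m) * ((m : ℝ) + 1) ^ 2
      ≤ (C * level n m ^ M * ‖toL2 n (z m)‖) * level n m ^ 2 :=
        mul_le_mul (h m (z m) (hz.1 m)) h1 (by positivity) (by positivity)
    _ = C * (level n m ^ (M + 2) * ‖toL2 n (z m)‖) := by ring
    _ ≤ C * C' := mul_le_mul_of_nonneg_left (hC' m) hC

theorem hasSum_inner {z : ℕ → 𝓢(Conf n, ℂ)} {w : 𝓢(Conf n, ℂ)} (h : HasSum z w)
    (g : 𝓢(Conf n, ℂ)) : HasSum (fun m => inner ℂ (toL2 n (z m)) (toL2 n g))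
      (inner ℂ (toL2 n w) (toL2 n g)) :=
  (h.mapL (toL2 n)).map (((innerSLFlip ℂ (toL2 n g)).toLinearMap).toAddMonoidHom)
    (innerSLFlip ℂ (toL2 n g)).continuous

/-- The Hermite expansion of a Schwartz function converges to it in Schwartz space. -/
theorem hasSum_hermiteProj (u : 𝓢(Conf n, ℂ)) : HasSum (fun m => hermiteProj m u) u := by
  obtain ⟨w, hw⟩ := (rapidlyDecreasing_hermiteProj u).exists_hasSum
  have h : w - u = 0 := by
    refine eq_zero_of_inner_eq_zero fun m g hg => ?_
    have h1 := hasSum_inner hw g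
    have h2 := hasSum_single (f := fun l => inner ℂ (toL2 n (hermiteProj l u)) (toL2 n g)) m
      fun l hl => inner_eq_zero_of_mem_hermiteSpace hl (hermiteProj_mem l u) hg
    rw [map_sub, inner_sub_left, h1.unique h2, inner_hermiteProj u hg, sub_self]
  rwa [sub_eq_zero.1 h] at hw

/-! ### Matrix elements of the Weyl operator -/

theorem tame_finset_sup (s : Finset (ℕ × ℕ)) :
    Tame (s.sup (schwartzSeminormFamily ℂ (Conf n) ℂ)) := by
  refine (tame_sum s (schwartzSeminormFamily ℂ (Conf n) ℂ) fun i _ =>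
    tame_seminorm i.1 i.2).mono 1 zero_le_one fun g => ?_
  rw [one_mul]
  refine Seminorm.finset_sup_apply_le (apply_nonneg _ _) fun i hi => ?_
  rw [_root_.sum_apply]
  exact Finset.single_le_sum (f := fun i => schwartzSeminormFamily ℂ (Conf n) ℂ i g)
    (fun i _ => apply_nonneg _ _) hi

/-- The kernel theorem estimate: the continuity of the Weyl kernel bounds all matrix elements by
one and the same seminorm. -/
theorem exists_tame_bound (f : 𝓢'(Conf n × Conf n, ℂ)) :
    ∃ (p : Seminorm ℂ 𝓢(Conf n, ℂ)) (C : ℝ), Tame p ∧ 0 ≤ C ∧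
      ∀ u v, ‖weylOp f u v‖ ≤ C * p v * p u := by
  obtain ⟨s, C, -, hC⟩ := Seminorm.bound_of_continuous
    (schwartz_withSeminorms ℂ (Conf n × Conf n) ℂ)
    ((normSeminorm ℂ ℂ).comp (weylKernel f).toLinearMap)
    (continuous_norm.comp (weylKernel f).continuous)
  let t : Finset (ℕ × ℕ) := s.biUnion fun i => Finset.Iic i
  let p : Seminorm ℂ 𝓢(Conf n, ℂ) := t.sup (schwartzSeminormFamily ℂ (Conf n) ℂ)
  have hp : ∀ i ∈ s, ∀ g, (Finset.Iic i).sup (schwartzSeminormFamily ℂ (Conf n) ℂ) g ≤ p g :=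
    fun i hi g => Finset.sup_mono (f := schwartzSeminormFamily ℂ (Conf n) ℂ)
      (Finset.subset_biUnion_of_mem (fun i => Finset.Iic i) hi) g
  -- the constants of `tensorFun_bound`, summed over the seminorms in `s`
  let B : ℝ := ∑ i ∈ s, 2 ^ i.2 * 2 ^ i.1 * 2 ^ i.1
  refine ⟨p, C * B, tame_finset_sup t, by positivity, fun u v => ?_⟩
  have h1 : ‖weylOp f u v‖ ≤
      C * s.sup (schwartzSeminormFamily ℂ (Conf n × Conf n) ℂ) (tensorLeftCLM u v) :=
    hC (tensorLeftCLM u v)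
  refine h1.trans ?_
  rw [mul_assoc, mul_assoc (C : ℝ)]
  refine mul_le_mul_of_nonneg_left ?_ C.2
  have hpv : 0 ≤ p v := apply_nonneg _ _
  have hpu : 0 ≤ p u := apply_nonneg _ _
  refine Seminorm.finset_sup_apply_le (by positivity) fun i hi => ?_
  refine SchwartzMap.seminorm_le_bound ℂ i.1 i.2 _ (by positivity) fun z => ?_
  refine (tensorFun_bound i.1 i.2 v u z).trans ?_
  have hv := hp i hi v
  have hu := hp i hi u
  have hB : (2 ^ i.2 * 2 ^ i.1 * 2 ^ i.1 : ℝ) ≤ B :=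
    Finset.single_le_sum (f := fun i : ℕ × ℕ => (2 ^ i.2 * 2 ^ i.1 * 2 ^ i.1 : ℝ))
      (fun i _ => by positivity) hi
  calc _ ≤ 2 ^ i.2 * (2 ^ i.1 * p v) * (2 ^ i.1 * p u) := by gcongr
    _ = (2 ^ i.2 * 2 ^ i.1 * 2 ^ i.1) * (p v * p u) := by ring
    _ ≤ B * (p v * p u) := mul_le_mul_of_nonneg_right hB (by positivity)

theorem hasSum_weylOp_left (f : 𝓢'(Conf n × Conf n, ℂ)) {z : ℕ → 𝓢(Conf n, ℂ)}
    {u : 𝓢(Conf n, ℂ)} (h : HasSum z u) (v : 𝓢(Conf n, ℂ)) :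
    HasSum (fun m => weylOp f (z m) v) (weylOp f u v) :=
  h.mapL ((weylKernel f).comp (tensorRightCLM v))

theorem hasSum_weylOp_right (f : 𝓢'(Conf n × Conf n, ℂ)) (u : 𝓢(Conf n, ℂ))
    {z : ℕ → 𝓢(Conf n, ℂ)} {v : 𝓢(Conf n, ℂ)} (h : HasSum z v) :
    HasSum (fun m => weylOp f u (z m)) (weylOp f u v) :=
  h.mapL ((weylKernel f).comp (tensorLeftCLM u))

/-- The Weyl operator of a constant of motion is block diagonal in the Hermite decomposition. -/
theorem weylOp_hermiteProj_right {f : 𝓢'(Conf n × Conf n, ℂ)}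
    (hf : IsTemperedConstantOfMotion f) (u v : 𝓢(Conf n, ℂ)) (m : ℕ) :
    weylOp f u (hermiteProj m v) = weylOp f (hermiteProj m u) (hermiteProj m v) := by
  have h1 := hasSum_weylOp_left f (hasSum_hermiteProj u) (hermiteProj m v)
  refine h1.unique (hasSum_single m fun l hl => ?_)
  refine weylOp_eq_zero_of_ne hf (hermiteOp_of_mem m (hermiteProj_mem m v))
    (hermiteOp_of_mem l (hermiteProj_mem l u)) fun e => hl ?_
  have : (l : ℝ) = m := by linarith
  exact_mod_cast this

theorem exists_block (f : 𝓢'(Conf n × Conf n, ℂ)) (u : 𝓢(Conf n, ℂ)) (m : ℕ) :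
    ∃ z ∈ hermiteSpace n m, ∀ v ∈ hermiteSpace n m,
      weylOp f (hermiteProj m u) v = inner ℂ (toL2 n z) (toL2 n v) :=
  exists_inner_eq (toL2 n).toLinearMap toL2_injective (hermiteSpace n m) (weylOp f (hermiteProj m u)).toLinearMap

/-- The Hermite function of degree `m` that represents `v ↦ Op(f) (P_m u) (v)` through the inner
product.  As the latter is conjugate linear in its first argument, this is the conjugate of the
degree `m` part of `Op(f) u`. -/
def block (f : 𝓢'(Conf n × Conf n, ℂ)) (u : 𝓢(Conf n, ℂ)) (m : ℕ) : 𝓢(Conf n, ℂ) :=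
  (exists_block f u m).choose

theorem block_mem (f : 𝓢'(Conf n × Conf n, ℂ)) (u : 𝓢(Conf n, ℂ)) (m : ℕ) :
    block f u m ∈ hermiteSpace n m := (exists_block f u m).choose_spec.1

theorem weylOp_hermiteProj_eq_inner_block (f : 𝓢'(Conf n × Conf n, ℂ)) (u : 𝓢(Conf n, ℂ))
    {m : ℕ} {v : 𝓢(Conf n, ℂ)} (hv : v ∈ hermiteSpace n m) :
    weylOp f (hermiteProj m u) v = inner ℂ (toL2 n (block f u m)) (toL2 n v) :=
  (exists_block f u m).choose_spec.2 v hv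

/-- The `L²` norm of a block is controlled by testing the matrix element on the block itself, which
costs only a fixed power of the level, against the rapid decay of `hermiteProj m u`. -/
theorem rapidlyDecreasing_block (f : 𝓢'(Conf n × Conf n, ℂ)) (u : 𝓢(Conf n, ℂ)) :
    RapidlyDecreasing (block f u) := by
  obtain ⟨p, C, hp, hC, hb⟩ := exists_tame_bound f
  obtain ⟨D, M, hD, hpD⟩ := hp.exists_le_level
  refine ⟨block_mem f u, fun N => ?_⟩
  obtain ⟨R, hR⟩ := (rapidlyDecreasing_hermiteProj u).2 (N + 2 * M)
  refine ⟨C * D * D * R, fun m => ?_⟩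
  have hl := level_pos (n := n) m
  have h1 : ‖toL2 n (block f u m)‖ ^ 2 ≤ C * p (block f u m) * p (hermiteProj m u) := by
    have h2 := hb (hermiteProj m u) (block f u m)
    rwa [weylOp_hermiteProj_eq_inner_block f u (block_mem f u m), inner_self_eq_norm_sq_to_K,
      norm_pow, RCLike.norm_ofReal, abs_norm] at h2
  have h3 := hpD m _ (block_mem f u m)
  have h4 := hpD m _ (hermiteProj_mem m u)
  set a := ‖toL2 n (block f u m)‖ with ha
  set b := ‖toL2 n (hermiteProj m u)‖ with hb'
  have h5 : a * a ≤ (C * D * D * (level n m ^ (2 * M) * b)) * a := by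
    calc a * a = a ^ 2 := (sq a).symm
      _ ≤ C * p (block f u m) * p (hermiteProj m u) := h1
      _ ≤ C * (D * level n m ^ M * a) * (D * level n m ^ M * b) := by gcongr
      _ = _ := by ring
  have h6 : a ≤ C * D * D * (level n m ^ (2 * M) * b) := by
    rcases (norm_nonneg (toL2 n (block f u m))).eq_or_lt with h0 | h0
    · rw [ha, ← h0]
      positivity
    · exact le_of_mul_le_mul_right h5 h0
  calc level n m ^ N * a ≤ level n m ^ N * (C * D * D * (level n m ^ (2 * M) * b)) := by gcongr
    _ = C * D * D * (level n m ^ (N + 2 * M) * b) := by ring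
    _ ≤ C * D * D * R := mul_le_mul_of_nonneg_left (hR m) (by positivity)

/-- The Schwartz function is the conjugate of the sum of the blocks, and it agrees with `Op(f) u` as
a distribution because both sides split along the Hermite expansion of the test function. -/
theorem exists_weylOp_eq_toTemperedDistributionCLM {f : 𝓢'(Conf n × Conf n, ℂ)}
    (hf : IsTemperedConstantOfMotion f) (u : 𝓢(Conf n, ℂ)) :
    ∃ w : 𝓢(Conf n, ℂ),
      weylOp f u = SchwartzMap.toTemperedDistributionCLM (Conf n) ℂ volume w := by
  obtain ⟨z, hz⟩ := (rapidlyDecreasing_block f u).exists_hasSum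
  refine ⟨conjOp n z, ?_⟩
  ext v
  have h1 : HasSum (fun m => weylOp f u (hermiteProj m v)) (weylOp f u v) :=
    hasSum_weylOp_right f u (hasSum_hermiteProj v)
  have h2 : ∀ m, weylOp f u (hermiteProj m v) = inner ℂ (toL2 n (block f u m)) (toL2 n v) := by
    intro m
    rw [weylOp_hermiteProj_right hf,
      weylOp_hermiteProj_eq_inner_block f u (hermiteProj_mem m v), ← inner_conj_symm,
      inner_hermiteProj v (block_mem f u m), inner_conj_symm]
  simp_rw [h2] at h1
  rw [h1.unique (hasSum_inner hz v), inner_toL2]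
  refine Eq.trans ?_ (SchwartzMap.toTemperedDistributionCLM_apply_apply _ _ _).symm
  refine MeasureTheory.integral_congr_ae (Filter.Eventually.of_forall fun x => ?_)
  simp only [RCLike.inner_apply', conjOp_apply, smul_eq_mul]
  exact mul_comm _ _

end

end WeylHO

theorem theorem3p6 (n : ℕ) (f : 𝓢'(WeylHO.Conf n × WeylHO.Conf n, ℂ))
    (hf : WeylHO.IsTemperedConstantOfMotion f) (u : 𝓢(WeylHO.Conf n, ℂ)) :
    ∃ w : 𝓢(WeylHO.Conf n, ℂ),
      WeylHO.weylOp f u =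
        SchwartzMap.toTemperedDistributionCLM (WeylHO.Conf n) ℂ MeasureTheory.volume w := by
  exact WeylHO.exists_weylOp_eq_toTemperedDistributionCLM hf u
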